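/- Let $R_1,R_2,\dots$ be i.i.d. integer-valued random variables with $\mathbb P(R_1\ge 1)=1$, and let $f:\mathbb R_+\to\mathbb R_+$ be a function with $f(r)=\mathbb P(R_1\ge r)$ for all integers $r\ge1$. For $n\ge 1$ let $U_1,U_2,\dots$ be i.i.d. uniform on $\mathbb Z/n\mathbb Z$, independent of the $R_k$, and put $C_0=\emptyset$, $C_k=C_{k-1}\cup\{U_k,U_k+1,\dots,U_k+R_k-1\}\subset\mathbb Z/n\mathbb Z$. Let $(N(t))_{t\ge0}$ be a rate $1$ Poisson process independent of $(R_k)_k,(U_k)_k$, and set $$\tau_n=\min\{k: C_k=\mathbb Z/n\mathbb Z\},\qquad T_n=\inf\{t\ge 0: C_{N(t)}=\mathbb Z/n\mathbb Z\},$$ which are almost surely finite. Suppose that one of the following holds. (i) $f$ is regularly varying at infinity with index $-1$, that is, $f$ is measurable and $\lim_{x\to\infty}f(tx)/f(x)=t^{-1}$ for all $t>0$, and for every $\beta\in(0,1)$ $$\limsup_{n\to\infty}\ \sup_{n^\beta\le x\le n}\frac{xf(x)}{nf(n)}<\infty\qquad\text{and}\qquad \limsup_{n\to\infty}\frac{\sum_{1\le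 i\le n^\beta}f(i)}{f(n)\,n\ln n}<\infty .$$ (ii) For some $b>-1$, $f(r)=\min\{\ln^b(r)/r,\,1\}$ for all sufficiently large integers $r$. Then $(f(n)T_n)_{n\ge1}$ is tight. Whenever $f(n_k)T_{n_k}$ converges in distribution to some $Y$ along a subsequence $(n_k)_k$, the law of $Y$ is non-degenerate (not concentrated at a single point), has compact support (the set of $y\in\mathbb R$ all of whose neighbourhoods have positive probability), and has no atom at $0$. Moreover $$\lim_{\alpha\downarrow0}\ \limsup_{n\to\infty}\ \mathbb P\big(f(n)T_n<\alpha\big)=0 .$$ The same statements hold with $\tau_n$ in place of $T_n$. -/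

import Mathlib

open MeasureTheory ProbabilityTheory Filter Topology Set
open scoped NNReal ENNReal

noncomputable section

namespace Covering

/-- `U : ℝ₊ → ℝ₊` is measurable and regularly varying at infinity with index `p`.
Only the values of `U` on the positive half-line matter. -/
structure IsRegularlyVarying (U : ℝ → ℝ) (p : ℝ) : Prop where
  measurable : Measurable ((Ioi (0 : ℝ)).domRestrict U)
  nonneg : ∀ x, 0 < x → 0 ≤ U x
  tendsto : ∀ t : ℝ, 0 < t → Tendsto (fun x : ℝ => U (x * t) / U x) atTop (𝓝 (t ^ p))

/-- The uniform bound: for every `β ∈ (0,1)`,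
`limsup_n sup_{n^β ≤ x ≤ n} x f(x) / (n f(n)) < ∞`. -/
def UniformBound (f : ℝ → ℝ) : Prop :=
  ∀ β : ℝ, 0 < β → β < 1 →
    limsup (fun n : ℕ => ⨆ x ∈ Icc ((n : ℝ) ^ β) (n : ℝ),
      ENNReal.ofReal (x * f x / (n * f n))) atTop < ⊤

/-- The partial-sum bound: for every `β ∈ (0,1)`,
`limsup_n (∑_{1 ≤ i ≤ n^β} f(i)) / (f(n) n ln n) < ∞`. -/
def PartialSumBound (f : ℝ → ℝ) : Prop :=
  ∀ β : ℝ, 0 < β → β < 1 →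
    limsup (fun n : ℕ => ENNReal.ofReal
      ((∑ i ∈ Finset.Icc 1 ⌊(n : ℝ) ^ β⌋₊, f i) / (f n * n * Real.log n))) atTop < ⊤

/-- `N` is a Poisson process with rate `1` on `[0,∞)`. -/
structure IsPoissonProcess {Ω : Type*} [MeasurableSpace Ω] (P : Measure Ω)
    (N : ℝ≥0 → Ω → ℕ) : Prop where
  measurable : ∀ t, Measurable (N t)
  zero : ∀ ω, N 0 ω = 0
  mono : ∀ ω, Monotone (fun t => N t ω)
  rightCont : ∀ ω t, ContinuousWithinAt (fun s => N s ω) (Ici t) t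
  indep : HasIndepIncrements N P
  law : ∀ s t, s ≤ t → HasLaw (fun ω => N t ω - N s ω) (poissonMeasure (t - s)) P

/-- The data of the covering process of `ℤ/nℤ`: i.i.d. radii `R k` with `ℙ(R k ≥ 1) = 1` and
`ℙ(R k ≥ r) = f r` for integers `r ≥ 1`, i.i.d. uniform positions `U k`, and a rate one Poisson
process `N`, where the radii, the positions and `N` are jointly independent. -/
structure IsCoveringModel (f : ℝ → ℝ) (n : ℕ) {Ω : Type*} [MeasurableSpace Ω] (P : Measure Ω)
    (R : ℕ → Ω → ℕ) (U : ℕ → Ω → ZMod n) (N : ℝ≥0 → Ω → ℕ) : Prop where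
  measurable_radius : ∀ k, Measurable (R k)
  measurable_position : ∀ k, Measurable (U k)
  one_le_radius : ∀ k, ∀ᵐ ω ∂P, 1 ≤ R k ω
  radius_tail : ∀ k, ∀ r : ℕ, 1 ≤ r → P.real {ω | r ≤ R k ω} = f r
  position_uniform : ∀ k, ∀ x : ZMod n, P {ω | U k ω = x} = (n : ℝ≥0∞)⁻¹
  poisson : IsPoissonProcess P N
  indep_pair : ∀ k, IndepFun (U k) (R k) P
  indep_objects : iIndepFun (fun k ω => (U k ω, R k ω)) P
  indep_poisson : IndepFun (fun ω k => (U k ω, R k ω)) (fun ω t => N t ω) P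

variable {Ω : Type*} {n : ℕ}

/-- The arc `{u, u + 1, …, u + r - 1}` of `ℤ/nℤ`. -/
def arc (u : ZMod n) (r : ℕ) : Set (ZMod n) := {x | ∃ j : ℕ, j < r ∧ x = u + (j : ZMod n)}

/-- The set covered by the first `k` objects. -/
def covered (R : ℕ → Ω → ℕ) (U : ℕ → Ω → ZMod n) (k : ℕ) (ω : Ω) : Set (ZMod n) :=
  ⋃ i < k, arc (U i ω) (R i ω)

/-- The continuous time covering process. -/
def coveredAt (R : ℕ → Ω → ℕ) (U : ℕ → Ω → ZMod n) (N : ℝ≥0 → Ω → ℕ) (t : ℝ≥0) (ω : Ω) :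
    Set (ZMod n) :=
  covered R U (N t ω) ω

/-- The discrete cover time `τ_n`. -/
def discreteCoverTime (R : ℕ → Ω → ℕ) (U : ℕ → Ω → ZMod n) (ω : Ω) : ℝ :=
  (sInf {k : ℕ | covered R U k ω = univ} : ℕ)

/-- The continuous cover time `T_n`. -/
def coverTime (R : ℕ → Ω → ℕ) (U : ℕ → Ω → ZMod n) (N : ℝ≥0 → Ω → ℕ) (ω : Ω) : ℝ :=
  (sInf {t : ℝ≥0 | coveredAt R U N t ω = univ} : ℝ≥0)

/-- The conclusions on the rescaled times `f(n) S_n`, `n ≥ 1`. The variables `S_n` may live on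
different probability spaces. -/
structure CompactSupportPhase {Ω : ℕ → Type*} [∀ n, MeasurableSpace (Ω n)]
    (P : ∀ n, Measure (Ω n)) [∀ n, IsProbabilityMeasure (P n)] (f : ℝ → ℝ)
    (S : ∀ n, Ω n → ℝ) : Prop where
  /-- Every `S_n` is a random variable. -/
  aemeasurable : ∀ n, 1 ≤ n → AEMeasurable (S n) (P n)
  /-- The sequence `(f(n) S_n)` is tight. -/
  tight : IsTightMeasureSet
    {μ : Measure ℝ | ∃ n : ℕ, 1 ≤ n ∧ μ = (P n).map (fun ω => f n * S n ω)}
  /-- Every limit in distribution (with law `ν`) along a subsequence is non-degenerate, has compact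
  support and has no atom at zero. -/
  limit : ∀ m : ℕ → ℕ, StrictMono m → (∀ k, 1 ≤ m k) →
    ∀ (ν : Measure ℝ) [IsProbabilityMeasure ν],
      TendstoInDistribution (fun k (ω : Ω (m k)) => f (m k) * S (m k) ω) atTop (id : ℝ → ℝ)
        (fun k => P (m k)) ν →
      (¬ ∃ c : ℝ, ν = Measure.dirac c) ∧ IsCompact ν.support ∧ ν {0} = 0
  /-- No mass accumulates at zero. -/
  no_mass_at_zero : Tendsto
    (fun α : ℝ => limsup (fun n : ℕ => P n {ω | f n * S n ω < α}) atTop) (𝓝[>] 0) (𝓝 0)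

end Covering

end

/-!
The time scale of the problem is `1 / f n`, the time at which a single object of radius at least
`n` appears. Everything is reduced to the probability that the first `k` objects cover `ℤ/nℤ`,
in terms of `k * f n`; the continuous cover time is compared with the discrete one by Chernoff
bounds for the Poisson clock.

* One object of radius at least `n` covers everything, so the circle is not covered by `k` objects
  with probability at most `exp (-k * f n)` (`prob_not_covered_le_exp`). This gives tightness, and
  it makes every limit charge each neighbourhood of zero.
* The support is compact because the intermediate scales help as well. For fixed `J` cut the circle
  into about `2 ^ J` intervals of length about `n / 2 ^ J`. Regular variation with index `-1` makes
  each of the `J` dyadic scales between `n / 2 ^ J` and `n` contribute an amount of order `f n` to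
  the probability that one object covers a given interval (`IsLogSpreadTail.eventually_le_sum`). When
  `k * f n` is larger than an absolute constant, an interval is missed with probability at most
  `exp (-2 * J)`, which beats the number of intervals as `J → ∞`.
* No mass accumulates at zero, by a second moment estimate for the number of vacant sites
  (`prob_covered_le_sum_exp`). The pair correlation of two vacant sites at distance `d` is at most
  `exp (4 * k * (ρ d + ρ (n - d)))`, where `ρ d` bounds the probability that one object covers a
  given arc of length `d`. By convexity it suffices to average `exp (8 * k * ρ d)`. The assumptions
  on `f` bound `ρ d` by a multiple of `f n * log (n / d)` for `d ≥ √n` and of `f n * log n` for all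
  `d`, so for `k * f n ≤ α` this exponential is at most a power `(n / d) ^ s` with `s` of order `α`
  when `d ≥ √n`, the other `d` being negligible, and its average tends to `1` as `α → 0`
  (`IsLogSpreadTail.eventually_sum_exp_le`).

A limit law gives no mass to `0` but charges every neighbourhood of it, hence it is not a point
mass. Only the values of `f` at integers enter; the properties that are used, collected in
`IsLogSpreadTail`, follow from either set of assumptions on `f`.
-/

namespace Covering

/-! ### Arcs and covered sets -/

lemma mem_arc_iff {n : ℕ} [NeZero n] {u x : ZMod n} {r : ℕ} :
    x ∈ arc u r ↔ (x - u).val < r := by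
  constructor
  · rintro ⟨j, hj, rfl⟩
    rw [add_sub_cancel_left, ZMod.val_natCast]
    exact (Nat.mod_le _ _).trans_lt hj
  · intro h
    exact ⟨_, h, by simp⟩

lemma covered_mono {Ω : Type*} {n : ℕ} (R : ℕ → Ω → ℕ) (U : ℕ → Ω → ZMod n) (ω : Ω) :
    Monotone fun k => covered R U k ω := by
  intro k l hkl
  exact biUnion_subset_biUnion_left fun i hi => lt_of_lt_of_le hi hkl

lemma covered_eq_univ_of_le {Ω : Type*} {n : ℕ} {R : ℕ → Ω → ℕ} {U : ℕ → Ω → ZMod n} {ω : Ω}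
    {k l : ℕ} (hkl : k ≤ l) (h : covered R U k ω = univ) : covered R U l ω = univ :=
  eq_univ_of_univ_subset (h ▸ covered_mono R U ω hkl)

lemma notMem_covered_iff {Ω : Type*} {n : ℕ} {R : ℕ → Ω → ℕ} {U : ℕ → Ω → ZMod n} {ω : Ω}
    {k : ℕ} {x : ZMod n} : x ∉ covered R U k ω ↔ ∀ i < k, x ∉ arc (U i ω) (R i ω) := by
  simp [covered]

/-- A sum over `ℤ/nℤ` of a function of the clockwise distance to `x` is a sum over `{0, …, n-1}`. -/
lemma sum_val_sub {M : Type*} [AddCommMonoid M] {n : ℕ} [NeZero n] (x : ZMod n) (g : ℕ → M) :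
    ∑ u : ZMod n, g (x - u).val = ∑ j ∈ Finset.range n, g j := by
  refine Finset.sum_nbij' (fun u => (x - u).val) (fun j => x - (j : ZMod n)) ?_ ?_ ?_ ?_ ?_
  · intro u _; simpa using ZMod.val_lt _
  · simp
  · intro u _; simp
  · intro j hj
    simp [ZMod.val_natCast, Nat.mod_eq_of_lt (Finset.mem_range.1 hj)]
  · simp

/-! ### One object, and independent objects -/

section Model

variable {Ω : Type*} [MeasurableSpace Ω] {P : Measure Ω} {f : ℝ → ℝ}
  {n : ℕ} {R : ℕ → Ω → ℕ} {U : ℕ → Ω → ZMod n} {N : ℝ≥0 → Ω → ℕ}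

namespace IsCoveringModel

lemma tail_nonneg (h : IsCoveringModel f n P R U N) {r : ℕ} (hr : 1 ≤ r) : 0 ≤ f r := by
  rw [← h.radius_tail 0 r hr]; exact measureReal_nonneg

/-- Independence of the objects: the probability that each of the first `k` objects satisfies a
given condition is a `k`-th power. -/
lemma prob_forall_lt [NeZero n] (h : IsCoveringModel f n P R U N) (A : Set (ZMod n × ℕ)) {p : ℝ}
    (hp : ∀ i, P.real {ω | (U i ω, R i ω) ∈ A} = p) (k : ℕ) :
    P.real {ω | ∀ i < k, (U i ω, R i ω) ∈ A} = p ^ k := by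
  have h1 := h.indep_objects.measure_inter_preimage_eq_mul (Finset.range k)
    (sets := fun _ => A) (fun _ _ => .of_discrete)
  have h2 : {ω | ∀ i < k, (U i ω, R i ω) ∈ A} =
      ⋂ i ∈ Finset.range k, (fun ω => (U i ω, R i ω)) ⁻¹' A := by
    ext ω; simp
  rw [h2, measureReal_def, h1, ENNReal.toReal_prod]
  have h3 (i : ℕ) : (P ((fun ω => (U i ω, R i ω)) ⁻¹' A)).toReal = p := hp i
  simp [h3]

lemma measurableSet_preimage [NeZero n] (h : IsCoveringModel f n P R U N) (i : ℕ)
    (A : Set (ZMod n × ℕ)) :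
    MeasurableSet {ω | (U i ω, R i ω) ∈ A} :=
  ((h.measurable_position i).prodMk (h.measurable_radius i)) (.of_discrete : MeasurableSet A)

lemma measurableSet_forall_lt [NeZero n] (h : IsCoveringModel f n P R U N)
    (A : Set (ZMod n × ℕ)) (k : ℕ) :
    MeasurableSet {ω | ∀ i < k, (U i ω, R i ω) ∈ A} := by
  simp only [ofPred_forall]
  exact .iInter fun i => .iInter fun _ => h.measurableSet_preimage i A

lemma measurableSet_notMem_covered [NeZero n] (h : IsCoveringModel f n P R U N)
    (k : ℕ) (x : ZMod n) :
    MeasurableSet {ω | x ∉ covered R U k ω} := by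
  simp only [notMem_covered_iff]
  exact h.measurableSet_forall_lt {z | x ∉ arc z.1 z.2} k

lemma measurableSet_covered_eq_univ [NeZero n] (h : IsCoveringModel f n P R U N) (k : ℕ) :
    MeasurableSet {ω | covered R U k ω = univ} := by
  have : {ω | covered R U k ω = univ} = ⋂ x : ZMod n, {ω | x ∉ covered R U k ω}ᶜ := by
    ext ω; simp [eq_univ_iff_forall]
  rw [this]
  exact .iInter fun x => (h.measurableSet_notMem_covered k x).compl

variable [IsProbabilityMeasure P]

lemma tail_le_one (h : IsCoveringModel f n P R U N) {r : ℕ} (hr : 1 ≤ r) : f r ≤ 1 := by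
  rw [← h.radius_tail 0 r hr]; exact measureReal_le_one

lemma tail_antitone (h : IsCoveringModel f n P R U N) {r s : ℕ} (hr : 1 ≤ r) (hrs : r ≤ s) :
    f s ≤ f r := by
  rw [← h.radius_tail 0 r hr, ← h.radius_tail 0 s (hr.trans hrs)]
  exact measureReal_mono fun ω (hω : s ≤ R 0 ω) => hrs.trans hω

lemma tail_one (h : IsCoveringModel f n P R U N) : f (1 : ℕ) = 1 := by
  rw [← h.radius_tail 0 1 le_rfl]
  have : P {ω | 1 ≤ R 0 ω} = 1 :=
    (mem_ae_iff_prob_eq_one (h.measurable_radius 0 measurableSet_Ici)).1 (h.one_le_radius 0)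
  simp [measureReal_def, this]

lemma tail_tendsto_zero (h : IsCoveringModel f n P R U N) :
    Tendsto (fun r : ℕ => f r) atTop (𝓝 0) := by
  have h1 : Tendsto (fun r : ℕ => P {ω | r ≤ R 0 ω}) atTop
      (𝓝 (P (⋂ r : ℕ, {ω | r ≤ R 0 ω}))) := by
    refine tendsto_measure_iInter_atTop
      (fun r => (h.measurable_radius 0 measurableSet_Ici).nullMeasurableSet) ?_ ⟨0, by simp⟩
    intro r s hrs ω (hω : s ≤ R 0 ω)
    exact hrs.trans hω
  have h2 : (⋂ r : ℕ, {ω | r ≤ R 0 ω}) = ∅ := by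
    ext ω
    simp only [mem_iInter, mem_ofPred_eq, mem_empty_iff_false, iff_false, not_forall, not_le]
    exact ⟨R 0 ω + 1, Nat.lt_succ_self _⟩
  rw [h2, measure_empty] at h1
  have h3 := (ENNReal.tendsto_toReal ENNReal.zero_ne_top).comp h1
  refine h3.congr' ?_
  filter_upwards [eventually_ge_atTop 1] with r hr
  exact h.radius_tail 0 r hr

variable [NeZero n]

/-- The probability that the radius exceeds a threshold depending on the position. -/
lemma prob_radius_ge (h : IsCoveringModel f n P R U N) (k : ℕ) {g : ZMod n → ℕ}
    (hg : ∀ u, 1 ≤ g u) :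
    P.real {ω | g (U k ω) ≤ R k ω} = (∑ u, f (g u)) / n := by
  have h1 : {ω | g (U k ω) ≤ R k ω} = ⋃ u : ZMod n, (U k ⁻¹' {u} ∩ R k ⁻¹' Ici (g u)) := by
    ext ω; simp
  have hm (u : ZMod n) : MeasurableSet (U k ⁻¹' {u} ∩ R k ⁻¹' Ici (g u)) :=
    (h.measurable_position k (measurableSet_singleton _)).inter
      (h.measurable_radius k measurableSet_Ici)
  rw [h1, measureReal_iUnion_fintype _ hm, Finset.sum_div]
  · refine Finset.sum_congr rfl fun u _ => ?_
    have h2 := (h.indep_pair k).measure_inter_preimage_eq_mul {u} (Ici (g u))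
      (measurableSet_singleton _) measurableSet_Ici
    have h3 : P (U k ⁻¹' {u}) = (n : ℝ≥0∞)⁻¹ := h.position_uniform k u
    have h4 : P.real (R k ⁻¹' Ici (g u)) = f (g u) := h.radius_tail k _ (hg u)
    rw [measureReal_def, h2, ENNReal.toReal_mul, ← measureReal_def, ← measureReal_def, h4,
      measureReal_def, h3]
    simp [div_eq_inv_mul]
  · intro u v huv
    refine Set.disjoint_left.2 ?_
    rintro ω ⟨h1, _⟩ ⟨h2, _⟩
    exact huv (h1.symm.trans h2)

/-- The probability that none of the first `k` objects has a radius above a threshold depending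
on its position. -/
lemma prob_forall_radius_lt (h : IsCoveringModel f n P R U N) {g : ZMod n → ℕ}
    (hg : ∀ u, 1 ≤ g u) (k : ℕ) :
    P.real {ω | ∀ i < k, R i ω < g (U i ω)} = (1 - (∑ u, f (g u)) / n) ^ k := by
  refine h.prob_forall_lt {z | z.2 < g z.1} (fun i => ?_) k
  have h1 : {ω | (U i ω, R i ω) ∈ {z : ZMod n × ℕ | z.2 < g z.1}} =
      {ω | g (U i ω) ≤ R i ω}ᶜ := by ext ω; simp
  rw [h1, probReal_compl_eq_one_sub, h.prob_radius_ge i hg]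
  exact h.measurableSet_preimage i {z | g z.1 ≤ z.2}

lemma prob_forall_radius_lt_le_exp (h : IsCoveringModel f n P R U N) {g : ZMod n → ℕ}
    (hg : ∀ u, 1 ≤ g u) (k : ℕ) :
    P.real {ω | ∀ i < k, R i ω < g (U i ω)} ≤ Real.exp (-(k * ((∑ u, f (g u)) / n))) := by
  rw [h.prob_forall_radius_lt hg k]
  have h0 : 0 ≤ 1 - (∑ u, f (g u)) / n := by
    rw [← h.prob_radius_ge 0 hg]
    linarith [measureReal_le_one (μ := P) (s := {ω | g (U 0 ω) ≤ R 0 ω})]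
  calc _ ≤ Real.exp (-((∑ u, f (g u)) / n)) ^ k := by
        gcongr; exact Real.one_sub_le_exp_neg _
    _ = _ := by rw [← Real.exp_nat_mul]; ring_nf

/-! ### Upper bounds for the probability that a vacant site remains -/

/-- A single object of radius at least `n` covers everything. -/
lemma prob_not_covered_le_exp (h : IsCoveringModel f n P R U N) (k : ℕ) :
    P.real {ω | covered R U k ω ≠ univ} ≤ Real.exp (-(k * f n)) := by
  have hn : 1 ≤ n := NeZero.one_le
  have h1 := h.prob_forall_radius_lt_le_exp (g := fun _ => n) (fun _ => hn) k
  have h2 : (∑ _u : ZMod n, f n) / n = f n := by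
    have : (n : ℝ) ≠ 0 := NeZero.ne _
    simp [ZMod.card]; field_simp
  rw [h2] at h1
  refine (measureReal_mono ?_).trans h1
  intro ω hω i hi
  by_contra! hc
  refine hω (eq_univ_of_forall fun x => ?_)
  by_contra hx
  exact notMem_covered_iff.1 hx i hi (mem_arc_iff.2 ((ZMod.val_lt _).trans_le hc))

/-- Union bound over the intervals of length `m` starting at the multiples of `m`: the circle is
covered if each of them is contained in one of the arcs. -/
lemma prob_not_covered_le_blocks (h : IsCoveringModel f n P R U N) {m : ℕ} (hm : 1 ≤ m) (k : ℕ) :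
    P.real {ω | covered R U k ω ≠ univ} ≤
      ((n / m : ℕ) + 1) * Real.exp (-(k * ((∑ j ∈ Finset.range n, f ((j + m : ℕ))) / n))) := by
  set B : ℕ → Set Ω := fun c =>
    {ω | ∀ i < k, R i ω < (((c * m : ℕ) : ZMod n) - U i ω).val + m} with hB
  have hB1 (c : ℕ) : P.real (B c) ≤
      Real.exp (-(k * ((∑ j ∈ Finset.range n, f ((j + m : ℕ))) / n))) := by
    have := h.prob_forall_radius_lt_le_exp
      (g := fun u => (((c * m : ℕ) : ZMod n) - u).val + m) (fun _ => by omega) k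
    rwa [sum_val_sub ((c * m : ℕ) : ZMod n) (fun j => f ((j + m : ℕ)))] at this
  have hsub : {ω | covered R U k ω ≠ univ} ⊆ ⋃ c ∈ Finset.range (n / m + 1), B c := by
    intro ω hω
    obtain ⟨y, hy⟩ := (ne_univ_iff_exists_notMem _).1 hω
    rw [notMem_covered_iff] at hy
    simp only [mem_iUnion, Finset.mem_range]
    refine ⟨y.val / m, Nat.lt_succ_of_le (Nat.div_le_div_right (ZMod.val_lt y).le), ?_⟩
    intro i hi
    have h1 := hy i hi
    rw [mem_arc_iff, not_lt] at h1
    refine lt_of_le_of_lt h1 ?_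
    have h2 : y - U i ω =
        (((y.val / m * m : ℕ) : ZMod n) - U i ω) + ((y.val % m : ℕ) : ZMod n) := by
      have : y = (((y.val / m * m + y.val % m : ℕ)) : ZMod n) := by
        rw [Nat.div_add_mod']; simp
      conv_lhs => rw [this]
      push_cast; ring
    rw [h2]
    refine (ZMod.val_add_le _ _).trans_lt ?_
    gcongr
    rw [ZMod.val_natCast]
    exact (Nat.mod_le _ _).trans_lt (Nat.mod_lt _ hm)
  calc _ ≤ P.real (⋃ c ∈ Finset.range (n / m + 1), B c) :=
        measureReal_mono hsub (measure_ne_top _ _)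
    _ ≤ ∑ c ∈ Finset.range (n / m + 1), P.real (B c) :=
        measureReal_biUnion_finset_le _ _
    _ ≤ ∑ c ∈ Finset.range (n / m + 1), _ := Finset.sum_le_sum fun c _ => hB1 c
    _ = _ := by simp

/-! ### The number of vacant sites -/

lemma prob_mem_arc (h : IsCoveringModel f n P R U N) (i : ℕ) (x : ZMod n) :
    P.real {ω | x ∈ arc (U i ω) (R i ω)} = (∑ j ∈ Finset.range n, f ((j + 1 : ℕ))) / n := by
  have h1 := h.prob_radius_ge i (g := fun u => (x - u).val + 1) (fun _ => by omega)
  rw [sum_val_sub x (fun j => f ((j + 1 : ℕ)))] at h1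
  simpa only [mem_arc_iff, Nat.lt_iff_add_one_le] using h1

/-- The probability that one object covers two sites at clockwise distance `d` is bounded by that
of covering one of the two arcs between them. -/
lemma prob_mem_arc_inter_le (h : IsCoveringModel f n P R U N) (i : ℕ) (x y : ZMod n) :
    P.real {ω | x ∈ arc (U i ω) (R i ω) ∧ y ∈ arc (U i ω) (R i ω)} ≤
      (∑ j ∈ Finset.Ico (y - x).val n, f ((j + 1 : ℕ)) +
        ∑ j ∈ Finset.Ico (n - (y - x).val) n, f ((j + 1 : ℕ))) / n := by
  set d := (y - x).val with hd
  have hdn : d < n := ZMod.val_lt _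
  have h1 : {ω | x ∈ arc (U i ω) (R i ω) ∧ y ∈ arc (U i ω) (R i ω)} =
      {ω | max (x - U i ω).val (((x - U i ω).val + d) % n) + 1 ≤ R i ω} := by
    ext ω
    have : (y - U i ω).val = ((x - U i ω).val + d) % n := by
      rw [hd, ← ZMod.val_add]; congr 1; ring
    simp only [mem_ofPred_eq, mem_arc_iff, this, Nat.add_one_le_iff, max_lt_iff]
  rw [h1, h.prob_radius_ge i (g := fun u => max (x - u).val (((x - u).val + d) % n) + 1)
    (fun _ => by omega), sum_val_sub x (fun j => f ((max j ((j + d) % n) + 1 : ℕ)))]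
  gcongr
  rw [← Finset.sum_range_add_sum_Ico _ (Nat.sub_le n d)]
  gcongr ?_ + ?_
  · rw [Finset.sum_Ico_eq_sum_range]
    refine (Finset.sum_congr rfl fun j hj => ?_).le
    rw [Finset.mem_range] at hj
    rw [Nat.mod_eq_of_lt (by omega), max_eq_right (by omega), add_comm j d]
  · exact Finset.sum_le_sum fun j hj => h.tail_antitone (by omega) (by omega)

lemma prob_notMem_covered (h : IsCoveringModel f n P R U N) (k : ℕ) (x : ZMod n) :
    P.real {ω | x ∉ covered R U k ω} =
      (1 - (∑ j ∈ Finset.range n, f ((j + 1 : ℕ))) / n) ^ k := by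
  simp only [notMem_covered_iff]
  refine h.prob_forall_lt {z | x ∉ arc z.1 z.2} (fun i => ?_) k
  rw [← h.prob_mem_arc i x]
  exact probReal_compl_eq_one_sub (h.measurableSet_preimage i {z | x ∈ arc z.1 z.2})

lemma prob_notMem_covered_inter_le (h : IsCoveringModel f n P R U N) (k : ℕ) (x y : ZMod n) :
    P.real {ω | x ∉ covered R U k ω ∧ y ∉ covered R U k ω} ≤
      (1 - 2 * ((∑ j ∈ Finset.range n, f ((j + 1 : ℕ))) / n) +
        (∑ j ∈ Finset.Ico (y - x).val n, f ((j + 1 : ℕ)) +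
        ∑ j ∈ Finset.Ico (n - (y - x).val) n, f ((j + 1 : ℕ))) / n) ^ k := by
  have hx (i : ℕ) := h.measurableSet_preimage i {z | x ∈ arc z.1 z.2}
  have hy (i : ℕ) := h.measurableSet_preimage i {z | y ∈ arc z.1 z.2}
  have h2 (i : ℕ) : P.real {ω | x ∉ arc (U i ω) (R i ω) ∧ y ∉ arc (U i ω) (R i ω)} =
      1 - 2 * ((∑ j ∈ Finset.range n, f ((j + 1 : ℕ))) / n) +
      P.real {ω | x ∈ arc (U i ω) (R i ω) ∧ y ∈ arc (U i ω) (R i ω)} := by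
    have h3 : {ω | x ∉ arc (U i ω) (R i ω) ∧ y ∉ arc (U i ω) (R i ω)} =
        ({ω | x ∈ arc (U i ω) (R i ω)} ∪ {ω | y ∈ arc (U i ω) (R i ω)})ᶜ := by
      ext ω; simp
    have h4 := measureReal_union_add_inter (μ := P)
      (s := {ω | x ∈ arc (U i ω) (R i ω)}) (t := {ω | y ∈ arc (U i ω) (R i ω)}) (hy i)
    rw [h.prob_mem_arc, h.prob_mem_arc] at h4
    rw [h3, probReal_compl_eq_one_sub (.union (hx i) (hy i) : MeasurableSet
      ({ω | x ∈ arc (U i ω) (R i ω)} ∪ {ω | y ∈ arc (U i ω) (R i ω)}))]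
    have h5 : {ω | x ∈ arc (U i ω) (R i ω) ∧ y ∈ arc (U i ω) (R i ω)} =
      {ω | x ∈ arc (U i ω) (R i ω)} ∩ {ω | y ∈ arc (U i ω) (R i ω)} := rfl
    rw [h5]; linarith
  have h6 (i : ℕ) : P.real {ω | x ∈ arc (U i ω) (R i ω) ∧ y ∈ arc (U i ω) (R i ω)} =
      P.real {ω | x ∈ arc (U 0 ω) (R 0 ω) ∧ y ∈ arc (U 0 ω) (R 0 ω)} := by
    set g : ZMod n → ℕ := fun u => max (x - u).val (y - u).val + 1
    have hg (u) : 1 ≤ g u := Nat.le_add_left _ _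
    have (i : ℕ) : {ω | x ∈ arc (U i ω) (R i ω) ∧ y ∈ arc (U i ω) (R i ω)} =
        {ω | g (U i ω) ≤ R i ω} := by
      ext ω
      simp only [mem_ofPred_eq, mem_arc_iff, g, Nat.add_one_le_iff, max_lt_iff]
    rw [this i, this 0, h.prob_radius_ge i hg, h.prob_radius_ge 0 hg]
  have h7 : {ω | x ∉ covered R U k ω ∧ y ∉ covered R U k ω} =
      {ω | ∀ i < k, (U i ω, R i ω) ∈ {z : ZMod n × ℕ | x ∉ arc z.1 z.2 ∧ y ∉ arc z.1 z.2}} := by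
    ext ω
    simp only [mem_ofPred_eq, notMem_covered_iff]
    exact ⟨fun H i hi => ⟨H.1 i hi, H.2 i hi⟩,
      fun H => ⟨fun i hi => (H i hi).1, fun i hi => (H i hi).2⟩⟩
  rw [h7, h.prob_forall_lt _ (fun i => (h2 i).trans (by rw [h6 i])) k]
  refine pow_le_pow_left₀ ?_ ?_ k
  · rw [← h2 0]; exact measureReal_nonneg
  · gcongr; exact h.prob_mem_arc_inter_le 0 x y

/-- Second moment bound: the circle is unlikely to be covered when the pair correlations of vacant
sites are close to one on average. -/
lemma prob_covered_le_sum_exp (h : IsCoveringModel f n P R U N) (k : ℕ)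
    (hq : (∑ j ∈ Finset.range n, f ((j + 1 : ℕ))) / n ≤ 1 / 2) :
    P.real {ω | covered R U k ω = univ} ≤
      (∑ d ∈ Finset.range n, Real.exp (4 * k * ((∑ j ∈ Finset.Ico d n, f ((j + 1 : ℕ)) +
        ∑ j ∈ Finset.Ico (n - d) n, f ((j + 1 : ℕ))) / n))) / n - 1 := by
  set q := (∑ j ∈ Finset.range n, f ((j + 1 : ℕ))) / n with hqdef
  set ρ : ℕ → ℝ := fun d => (∑ j ∈ Finset.Ico d n, f ((j + 1 : ℕ)) +
        ∑ j ∈ Finset.Ico (n - d) n, f ((j + 1 : ℕ))) / n with hρ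
  have hρ0 (d : ℕ) : 0 ≤ ρ d := by
    refine div_nonneg (add_nonneg ?_ ?_) (Nat.cast_nonneg _) <;>
    exact Finset.sum_nonneg fun j _ => h.tail_nonneg (by omega)
  have hn : (0 : ℝ) < n := by exact_mod_cast NeZero.pos n
  set A : ZMod n → Set Ω := fun x => {ω | x ∉ covered R U k ω} with hA
  have hAm (x) : MeasurableSet (A x) := h.measurableSet_notMem_covered k x
  set V : Ω → ℝ := fun ω => ∑ x, (A x).indicator 1 ω with hV
  have hind (x) : MemLp ((A x).indicator (1 : Ω → ℝ)) 2 P :=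
    (memLp_const 1).indicator (hAm x)
  have hVL : MemLp V 2 P := memLp_finsetSum _ fun x _ => hind x
  have hint (B : Set Ω) (hB : MeasurableSet B) : Integrable (B.indicator (1 : Ω → ℝ)) P :=
    (integrable_const 1).indicator hB
  set p := (1 - q) ^ k with hp
  have hp0 : 0 < p := pow_pos (by linarith) k
  have hEV : ∫ ω, V ω ∂P = n * p := by
    rw [integral_finsetSum _ fun x _ => hint _ (hAm x)]
    simp only [integral_indicator_one (hAm _)]
    simp [hA, h.prob_notMem_covered, ZMod.card, hp, hqdef]
  have hEV2 : ∫ ω, (V ^ 2) ω ∂P ≤ n * (p ^ 2 * ∑ d ∈ Finset.range n, Real.exp (4 * k * ρ d)) := by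
    have e1 : V ^ 2 = fun ω => ∑ x, ∑ y, (A x ∩ A y).indicator (1 : Ω → ℝ) ω := by
      ext ω
      simp only [hV, Pi.pow_apply, sq, Finset.sum_mul_sum]
      refine Finset.sum_congr rfl fun x _ => Finset.sum_congr rfl fun y _ => ?_
      rw [Set.inter_indicator_one]; rfl
    rw [e1, integral_finsetSum _ fun x _ => integrable_finsetSum _ fun y _ =>
      hint _ ((hAm x).inter (hAm y))]
    have e2 (x : ZMod n) : ∫ ω, ∑ y, (A x ∩ A y).indicator (1 : Ω → ℝ) ω ∂P ≤
        p ^ 2 * ∑ d ∈ Finset.range n, Real.exp (4 * k * ρ d) := by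
      rw [integral_finsetSum _ fun y _ => hint _ ((hAm x).inter (hAm y))]
      simp only [integral_indicator_one ((hAm _).inter (hAm _))]
      have e3 (y : ZMod n) : P.real (A x ∩ A y) ≤ p ^ 2 * Real.exp (4 * k * ρ (y - x).val) := by
        have e4 := h.prob_notMem_covered_inter_le k x y
        refine e4.trans ?_
        have e5 : 0 ≤ 1 - 2 * q + ρ (y - x).val := by linarith [hρ0 (y - x).val]
        -- the hypothesis `q ≤ 1 / 2` gives `ρ ≤ (1 - q) ^ 2 * (4 * ρ)`
        have e6 : 1 - 2 * q + ρ (y - x).val ≤ (1 - q) ^ 2 * Real.exp (4 * ρ (y - x).val) := by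
          have := Real.add_one_le_exp (4 * ρ (y - x).val)
          have h4 : 1 / 4 ≤ (1 - q) ^ 2 := by nlinarith
          have := mul_le_mul_of_nonneg_left this (sq_nonneg (1 - q))
          nlinarith [hρ0 (y - x).val, sq_nonneg q]
        calc _ ≤ ((1 - q) ^ 2 * Real.exp (4 * ρ (y - x).val)) ^ k := pow_le_pow_left₀ e5 e6 k
          _ = _ := by rw [mul_pow, ← Real.exp_nat_mul, hp, ← pow_mul, ← pow_mul]; ring_nf
      refine (Finset.sum_le_sum fun y _ => e3 y).trans ?_
      rw [← Finset.mul_sum]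
      gcongr
      rw [← sum_val_sub (n := n) 0 (fun d => Real.exp (4 * k * ρ d))]
      refine (Fintype.sum_equiv (Equiv.subRight x |>.trans (Equiv.neg _)) _ _ fun y => ?_).le
      simp
    refine (Finset.sum_le_sum fun x _ => e2 x).trans ?_
    simp [ZMod.card]
  -- Chebyshev: on a covered circle `V = 0` deviates from its mean `n * p` by `n * p`
  have hsub : {ω | covered R U k ω = univ} ⊆ {ω | n * p ≤ |V ω - ∫ ω, V ω ∂P|} := by
    intro ω (hω : covered R U k ω = univ)
    have : V ω = 0 := Finset.sum_eq_zero fun x _ => by simp [hA, hω]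
    simp only [mem_ofPred_eq, this, hEV, zero_sub, abs_neg]
    exact le_abs_self _
  have hch := meas_ge_le_variance_div_sq hVL (mul_pos hn hp0)
  have hfin : P.real {ω | covered R U k ω = univ} ≤ Var[V; P] / (n * p) ^ 2 :=
    (measureReal_mono hsub).trans
      (ENNReal.toReal_le_of_le_ofReal (div_nonneg (variance_nonneg _ _) (sq_nonneg _)) hch)
  refine hfin.trans ?_
  change _ ≤ (∑ d ∈ Finset.range n, Real.exp (4 * k * ρ d)) / n - 1
  rw [variance_eq_sub hVL, hEV, div_le_iff₀ (by positivity)]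
  refine (sub_le_sub_right hEV2 _).trans (le_of_eq ?_)
  rw [div_sub_one hn.ne']
  field_simp

end IsCoveringModel

end Model

/-! ### Tails that are regularly spread over the logarithmic scales -/

/-- The properties of the tail `a r = ℙ(R ≥ r)`, on the integers only, that the covering argument
needs. `dyadic` is the part of regular variation with index `-1` that bounds the tail from below
at smaller dyadic scales, up to a factor `2`. `uniform` and `partialSum` are the two growth
assumptions for the single exponent `β = 1 / 2`, with `limsup < ∞` written as an eventual bound. -/
structure IsLogSpreadTail (a : ℕ → ℝ) : Prop where
  pos : ∀ᶠ n in atTop, 0 < a n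
  dyadic : ∀ j : ℕ, ∀ᶠ m : ℕ in atTop, 2 ^ j * a (2 ^ j * m) ≤ 2 * a m
  uniform : ∃ K : ℝ, ∀ᶠ n : ℕ in atTop, ∀ i : ℕ, √(n : ℝ) ≤ i → i ≤ n → i * a i ≤ K * (n * a n)
  partialSum : ∃ K : ℝ, ∀ᶠ n : ℕ in atTop,
    ∑ i ∈ Finset.Icc 1 ⌊√(n : ℝ)⌋₊, a i ≤ K * (n * a n * Real.log n)

namespace IsLogSpreadTail

variable {a : ℕ → ℝ}

/-- Each of the `J` dyadic scales below `n` contributes an amount of order `n * a n` to the sum of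
the tail. -/
lemma eventually_le_sum (ha : IsLogSpreadTail a) (h0 : ∀ r, 1 ≤ r → 0 ≤ a r)
    (hanti : ∀ r s, 1 ≤ r → r ≤ s → a s ≤ a r) (J : ℕ) :
    ∀ᶠ n : ℕ in atTop, 1 ≤ n / 2 ^ J ∧ n / (n / 2 ^ J) + 1 ≤ 2 ^ (J + 2) ∧
      J * a n / 8 ≤ (∑ j ∈ Finset.range n, a (j + n / 2 ^ J)) / n := by
  have h1 : ∀ᶠ m in atTop, ∀ j ∈ Finset.range J, 2 ^ j * a (2 ^ j * m) ≤ 2 * a m :=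
    (eventually_all_finset _).2 fun j _ => ha.dyadic j
  obtain ⟨M, hM⟩ := eventually_atTop.1 h1
  filter_upwards [eventually_ge_atTop ((M + 1) * 2 ^ J)] with n hn
  have hJ : 0 < 2 ^ J := by positivity
  set m := n / 2 ^ J with hm
  have hMm : M + 1 ≤ m := (Nat.le_div_iff_mul_le hJ).2 hn
  have hm1 : 1 ≤ m := by omega
  have hmn : m * 2 ^ J ≤ n := Nat.div_mul_le_self n _
  have hnm : n < (m + 1) * 2 ^ J := by
    rw [mul_comm]; exact Nat.lt_mul_div_succ n hJ
  have hnm2 : n ≤ 2 * (m * 2 ^ J) := by nlinarith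
  refine ⟨hm1, ?_, ?_⟩
  · have : n / m ≤ 2 * 2 ^ J := by
      refine Nat.div_le_of_le_mul ?_
      rw [mul_left_comm]; exact hnm2
    have : 1 ≤ 2 ^ J := hJ
    rw [pow_add]; omega
  -- the scale `[m * 2 ^ l, m * 2 ^ (l + 1))` contributes at least `m * 2 ^ J * a (m * 2 ^ J) / 4`
  have hstep (l : ℕ) (hl : l ≤ J) :
      l * (m * 2 ^ J * a (m * 2 ^ J) / 4) ≤ ∑ i ∈ Finset.Ico m (m * 2 ^ l), a i := by
    induction l with
    | zero => simp
    | succ l ih =>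
      have hb : m * 2 ^ l ≤ m * 2 ^ (l + 1) := by gcongr <;> omega
      have hb0 : m ≤ m * 2 ^ l := Nat.le_mul_of_pos_right _ (by positivity)
      rw [← Finset.sum_Ico_consecutive _ hb0 hb]
      have h2 : ∑ i ∈ Finset.Ico (m * 2 ^ l) (m * 2 ^ (l + 1)), a (m * 2 ^ (l + 1)) ≤
          ∑ i ∈ Finset.Ico (m * 2 ^ l) (m * 2 ^ (l + 1)), a i := by
        refine Finset.sum_le_sum fun i hi => ?_
        rw [Finset.mem_Ico] at hi
        exact hanti _ _ (by omega) hi.2.le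
      have h3 := hM (m * 2 ^ (l + 1)) (by omega) (J - (l + 1)) (by simp; omega)
      have h4 : 2 ^ (J - (l + 1)) * (m * 2 ^ (l + 1)) = m * 2 ^ J := by
        rw [mul_left_comm, ← pow_add]; congr 2; omega
      rw [h4] at h3
      have h5 : (2 : ℝ) ^ J = 2 ^ (J - (l + 1)) * (2 * 2 ^ l) := by
        rw [← pow_succ', ← pow_add]; congr 1; omega
      have h6 : m * 2 ^ J * a (m * 2 ^ J) / 4 ≤ m * 2 ^ l * a (m * 2 ^ (l + 1)) := by
        have := mul_le_mul_of_nonneg_left h3 (show (0 : ℝ) ≤ m * 2 ^ l / 2 by positivity)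
        rw [h5]
        linarith
      have h7 : m * 2 ^ (l + 1) - m * 2 ^ l = m * 2 ^ l := by
        rw [pow_succ, ← mul_assoc]; omega
      rw [Finset.sum_const, Nat.card_Ico, h7, nsmul_eq_mul] at h2
      push_cast at h2 ⊢
      linarith [ih (by omega)]
  have h8 : ∑ i ∈ Finset.Ico m (m * 2 ^ J), a i ≤ ∑ j ∈ Finset.range n, a (j + m) := by
    have : ∑ j ∈ Finset.range n, a (j + m) = ∑ i ∈ Finset.Ico m (n + m), a i := by
      rw [Finset.sum_Ico_eq_sum_range]; simp [add_comm]
    rw [this]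
    refine Finset.sum_le_sum_of_subset_of_nonneg ?_ fun i hi _ => h0 i ?_
    · exact Finset.Ico_subset_Ico_right (by omega)
    · rw [Finset.mem_Ico] at hi; omega
  have hn0 : (0 : ℝ) < n := by
    have : 0 < n := by nlinarith
    exact_mod_cast this
  rw [le_div_iff₀ hn0]
  refine le_trans ?_ ((hstep J le_rfl).trans h8)
  have h9 : a n ≤ a (m * 2 ^ J) := hanti _ _ (by nlinarith) hmn
  have h10 : (n : ℝ) ≤ 2 * (m * 2 ^ J) := by exact_mod_cast hnm2
  have h11 : 0 ≤ a n := h0 _ (by nlinarith)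
  have h12 : n * a n ≤ 2 * (m * 2 ^ J) * a (m * 2 ^ J) := by gcongr
  have := mul_le_mul_of_nonneg_left h12 (show (0 : ℝ) ≤ J / 8 by positivity)
  linarith

end IsLogSpreadTail

/-! ### Power and logarithmic sums -/

lemma sum_Ico_inv_le_log {d n : ℕ} (hd : 1 ≤ d) (hdn : d ≤ n) :
    ∑ j ∈ Finset.Ico d n, ((j : ℝ) + 1)⁻¹ ≤ Real.log (n / d) := by
  have hd0 : (0 : ℝ) < d := by exact_mod_cast hd
  induction n, hdn using Nat.le_induction with
  | base => simp [hd0.ne']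
  | succ n hn ih =>
    have hn0 : (0 : ℝ) < n := hd0.trans_le (by exact_mod_cast hn)
    rw [Finset.sum_Ico_succ_top hn]
    have h1 := Real.one_sub_inv_le_log_of_pos (show (0 : ℝ) < (n + 1) / n by positivity)
    have h2 : Real.log ((n + 1) / n) = Real.log ((n + 1 : ℕ) / d) - Real.log (n / d) := by
      rw [← Real.log_div (by positivity) (by positivity)]
      congr 1; push_cast; field_simp
    have h3 : 1 - ((n + 1 : ℝ) / n)⁻¹ = ((n : ℝ) + 1)⁻¹ := by field_simp; ring
    linarith

lemma sum_Ico_inv_sqrt_le (n : ℕ) : ∑ d ∈ Finset.Ico 1 n, (√(d : ℝ))⁻¹ ≤ 2 * √(n : ℝ) := by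
  have h (n : ℕ) : ∑ d ∈ Finset.Ico 1 (n + 1), (√(d : ℝ))⁻¹ ≤ 2 * √(n : ℝ) := by
    induction n with
    | zero => simp
    | succ n ih =>
      rw [Finset.sum_Ico_succ_top (by omega)]
      have h1 : (0 : ℝ) < √((n + 1 : ℕ) : ℝ) := Real.sqrt_pos.2 (by positivity)
      have h2 : √(n : ℝ) ≤ √((n + 1 : ℕ) : ℝ) := Real.sqrt_le_sqrt (by simp)
      have h3 := Real.sq_sqrt (show (0 : ℝ) ≤ n by positivity)
      have h4 := Real.sq_sqrt (show (0 : ℝ) ≤ ((n + 1 : ℕ) : ℝ) by positivity)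
      have h5 : (√((n + 1 : ℕ) : ℝ))⁻¹ ≤ 2 * √((n + 1 : ℕ) : ℝ) - 2 * √(n : ℝ) := by
        rw [inv_le_iff_one_le_mul₀' h1]
        push_cast at h4 ⊢
        nlinarith [sq_nonneg (√((n : ℝ) + 1) - √(n : ℝ))]
      linarith
  rcases n with _ | n
  · simp
  · refine (h n).trans ?_
    gcongr; simp

/-- A function on `{0, …, n-1}` dominated by a small power of `n / d` is close to `1` on average.
The bound `n ^ (1/4)` controls the few values `d < √n`. -/
lemma sum_range_le_of_le_rpow {n : ℕ} (hn : 1 ≤ n) {s : ℝ} (hs0 : 0 ≤ s) (hs : s ≤ 1 / 2)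
    {E : ℕ → ℝ} (h1 : ∀ d < n, E d ≤ (n : ℝ) ^ (1 / 4 : ℝ))
    (h2 : ∀ d < n, ⌊√(n : ℝ)⌋₊ ≤ d → E d ≤ ((n : ℝ) / d) ^ s) :
    ∑ d ∈ Finset.range n, E d ≤ n * (n : ℝ) ^ (-(1 / 4) : ℝ) + n + 4 * s * n := by
  set r := ⌊√(n : ℝ)⌋₊ with hr
  have hn1 : (1 : ℝ) ≤ n := by exact_mod_cast hn
  have hn0 : (0 : ℝ) < n := by linarith
  have hr1 : 1 ≤ r := Nat.le_floor (by simpa using Real.one_le_sqrt.2 hn1)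
  have hrs : (r : ℝ) ≤ √(n : ℝ) := Nat.floor_le (Real.sqrt_nonneg _)
  have hrn : r ≤ n := by
    have : √(n : ℝ) ≤ n := Real.sqrt_le_self_iff.2 (Or.inr hn1)
    exact_mod_cast hrs.trans this
  rw [← Finset.sum_range_add_sum_Ico _ hrn, add_assoc]
  refine add_le_add ?_ ?_
  · calc _ ≤ ∑ d ∈ Finset.range r, (n : ℝ) ^ (1 / 4 : ℝ) :=
          Finset.sum_le_sum fun d hd => h1 d ((Finset.mem_range.1 hd).trans_le hrn)
      _ = r * (n : ℝ) ^ (1 / 4 : ℝ) := by simp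
      _ ≤ √(n : ℝ) * (n : ℝ) ^ (1 / 4 : ℝ) := by gcongr
      _ = (n : ℝ) ^ ((3 : ℝ) / 4) := by
          rw [Real.sqrt_eq_rpow, ← Real.rpow_add hn0]; norm_num
      _ = _ := by
          rw [← Real.rpow_one_add' hn0.le (by norm_num)]; norm_num
  · have h3 (d : ℕ) (hd : d ∈ Finset.Ico r n) : E d ≤ 1 + 2 * s * (√(n : ℝ) * (√(d : ℝ))⁻¹) := by
      rw [Finset.mem_Ico] at hd
      refine (h2 d hd.2 hd.1).trans ?_
      have hx : (0 : ℝ) ≤ n / d := by positivity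
      -- Young's inequality: `x ^ (2 s) ≤ 2 s x + (1 - 2 s)` for `x = √(n / d)`
      have h4 := Real.geom_mean_le_arith_mean2_weighted (show 0 ≤ 2 * s by linarith)
        (show 0 ≤ 1 - 2 * s by linarith) (Real.sqrt_nonneg ((n : ℝ) / d)) zero_le_one (by ring)
      rw [Real.one_rpow, mul_one, Real.sqrt_eq_rpow, ← Real.rpow_mul hx, ← Real.sqrt_eq_rpow,
        show 1 / 2 * (2 * s) = s by ring, Real.sqrt_div' _ (by positivity),
        div_eq_mul_inv (√_)] at h4
      linarith
    have h5 : 0 ≤ 2 * s * √(n : ℝ) := by positivity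
    calc _ ≤ ∑ d ∈ Finset.Ico r n, (1 + 2 * s * (√(n : ℝ) * (√(d : ℝ))⁻¹)) :=
          Finset.sum_le_sum h3
      _ ≤ ∑ d ∈ Finset.Ico 1 n, (1 + 2 * s * (√(n : ℝ) * (√(d : ℝ))⁻¹)) :=
          Finset.sum_le_sum_of_subset_of_nonneg (Finset.Ico_subset_Ico_left hr1)
            fun d _ _ => by positivity
      _ = (n - 1 : ℕ) + 2 * s * √(n : ℝ) * ∑ d ∈ Finset.Ico 1 n, (√(d : ℝ))⁻¹ := by
          rw [Finset.sum_add_distrib, Finset.mul_sum]; simp [mul_assoc]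
      _ ≤ n + 2 * s * √(n : ℝ) * (2 * √(n : ℝ)) := by
          gcongr
          · exact Nat.sub_le _ _
          · exact sum_Ico_inv_sqrt_le n
      _ = _ := by
          have := Real.mul_self_sqrt hn0.le
          linear_combination 4 * s * this

namespace IsLogSpreadTail

variable {a : ℕ → ℝ}

/-- The logarithmic growth of the sum of the tail keeps the average pair correlation of vacant
sites close to `1` up to a small multiple of the time `1 / a n`. -/
lemma eventually_sum_exp_le (ha : IsLogSpreadTail a) (h0 : ∀ r, 1 ≤ r → 0 ≤ a r) {ε : ℝ}
    (hε : 0 < ε) : ∃ α > 0, ∀ᶠ n : ℕ in atTop, ∀ k : ℕ, k * a n ≤ α →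
      (∑ d ∈ Finset.range n, Real.exp (4 * k * ((∑ j ∈ Finset.Ico d n, a (j + 1) +
        ∑ j ∈ Finset.Ico (n - d) n, a (j + 1)) / n))) / n - 1 ≤ ε := by
  obtain ⟨K₁, hK₁⟩ := ha.uniform
  obtain ⟨K₂, hK₂⟩ := ha.partialSum
  set K := max 1 (max K₁ K₂) with hK
  have hK1 : 1 ≤ K := le_max_left _ _
  have hK11 : K₁ ≤ K := (le_max_left _ _).trans (le_max_right _ _)
  have hK22 : K₂ ≤ K := (le_max_right _ _).trans (le_max_right _ _)
  set s := min (1 / 8) (ε / 8) with hs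
  have hs0 : 0 < s := lt_min (by norm_num) (by positivity)
  have hs8 : s ≤ 1 / 8 := min_le_left _ _
  have hsε : s ≤ ε / 8 := min_le_right _ _
  refine ⟨s / (8 * K), by positivity, ?_⟩
  have hlim : Tendsto (fun n : ℕ => (n : ℝ) ^ (-(1 / 4) : ℝ)) atTop (𝓝 0) :=
    (tendsto_rpow_neg_atTop (by norm_num)).comp tendsto_natCast_atTop_atTop
  filter_upwards [hK₁, hK₂, eventually_ge_atTop 1, hlim.eventually_le_const (half_pos hε)]
    with n hu hp hn hnε k hk
  have hn1 : (1 : ℝ) ≤ n := by exact_mod_cast hn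
  have hn0 : (0 : ℝ) < n := by linarith
  have han : 0 ≤ a n := h0 n hn
  set F : ℕ → ℝ := fun d => ∑ j ∈ Finset.Ico d n, a (j + 1) with hF
  set r := ⌊√(n : ℝ)⌋₊ with hr
  have hr1 : 1 ≤ r := Nat.le_floor (by simpa using Real.one_le_sqrt.2 hn1)
  have hrs : (r : ℝ) ≤ √(n : ℝ) := Nat.floor_le (Real.sqrt_nonneg _)
  have hrn : r ≤ n := by
    have : √(n : ℝ) ≤ n := Real.sqrt_le_self_iff.2 (Or.inr hn1)
    exact_mod_cast hrs.trans this
  have hFanti (d e : ℕ) (hde : d ≤ e) : F e ≤ F d :=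
    Finset.sum_le_sum_of_subset_of_nonneg (Finset.Ico_subset_Ico_left hde)
      fun j _ _ => h0 _ (by omega)
  have hF1 (d : ℕ) (hd : r ≤ d) (hdn : d ≤ n) : F d ≤ K * (n * a n) * Real.log (n / d) := by
    have h1 : F d ≤ ∑ j ∈ Finset.Ico d n, K * (n * a n) * ((j : ℝ) + 1)⁻¹ := by
      refine Finset.sum_le_sum fun j hj => ?_
      rw [Finset.mem_Ico] at hj
      have h2 : √(n : ℝ) ≤ ((j + 1 : ℕ) : ℝ) := by
        refine (Nat.lt_floor_add_one _).le.trans ?_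
        push_cast; gcongr; exact hd.trans hj.1
      have h3 := hu (j + 1) h2 (by omega)
      rw [← div_eq_mul_inv, le_div_iff₀ (by positivity), mul_comm]
      push_cast at h3
      refine h3.trans ?_
      gcongr
    rw [← Finset.mul_sum] at h1
    refine h1.trans ?_
    gcongr
    exact sum_Ico_inv_le_log (hr1.trans hd) hdn
  have hF0 : F 0 ≤ 2 * K * (n * a n) * Real.log n := by
    have h1 : F 0 = ∑ i ∈ Finset.Icc 1 r, a i + F r := by
      have h2 : ∑ i ∈ Finset.Icc 1 r, a i = ∑ j ∈ Finset.range r, a (j + 1) := by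
        rw [Finset.range_eq_Ico, Finset.sum_Ico_add' a 0 r 1, zero_add]; rfl
      rw [h2, Finset.sum_range_add_sum_Ico _ hrn, hF, Finset.range_eq_Ico]
    have h3 := hF1 r le_rfl hrn
    have h4 : Real.log (n / r) ≤ Real.log n := by
      have : (1 : ℝ) ≤ r := by exact_mod_cast hr1
      exact Real.log_le_log (by positivity) (div_le_self hn0.le this)
    have hl : 0 ≤ Real.log n := Real.log_nonneg hn1
    have h5 : K * (n * a n) * Real.log (n / r) ≤ K * (n * a n) * Real.log n := by gcongr
    have h6 : K₂ * (n * a n * Real.log n) ≤ K * (n * a n * Real.log n) := by gcongr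
    rw [h1]; linarith
  -- the exponent after symmetrization
  have hexp (L d : ℝ) (hL : 0 ≤ L) (hd : d ≤ K * (n * a n) * L) :
      2 * (4 * k / n) * d ≤ s * L := by
    calc _ ≤ 2 * (4 * k / n) * (K * (n * a n) * L) := by gcongr
      _ = 8 * K * (k * a n) * L := by field_simp; ring
      _ ≤ 8 * K * (s / (8 * K)) * L := by gcongr
      _ = s * L := by field_simp
  have hsum : ∑ d ∈ Finset.range n, Real.exp (2 * (4 * k / n) * F d) ≤
      n * (n : ℝ) ^ (-(1 / 4) : ℝ) + n + 4 * s * n := by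
    refine sum_range_le_of_le_rpow hn hs0.le (by linarith) (fun d _ => ?_) (fun d hdn hd => ?_)
    · rw [Real.rpow_def_of_pos hn0, Real.exp_le_exp]
      have hl : 0 ≤ Real.log n := Real.log_nonneg hn1
      have := hexp (2 * Real.log n) (F d) (by positivity)
        (((hFanti 0 d (Nat.zero_le _)).trans hF0).trans_eq (by ring))
      nlinarith
    · have hd0 : (0 : ℝ) < d := by exact_mod_cast hr1.trans hd
      have hdn' : (1 : ℝ) ≤ n / d := by
        rw [one_le_div hd0]; exact_mod_cast hdn.le
      rw [Real.rpow_def_of_pos (by positivity), Real.exp_le_exp, mul_comm _ s]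
      exact hexp _ _ (Real.log_nonneg hdn') (hF1 d hd hdn.le)
  -- `2 * exp (x + y) ≤ exp (2 * x) + exp (2 * y)` removes the arc of length `n - d`
  have hsym : ∑ d ∈ Finset.range n, Real.exp (4 * k * ((F d + F (n - d)) / n)) ≤
      ∑ d ∈ Finset.range n, Real.exp (2 * (4 * k / n) * F d) := by
    have h1 (d : ℕ) : Real.exp (4 * k * ((F d + F (n - d)) / n)) ≤
        (Real.exp (2 * (4 * k / n) * F d) + Real.exp (2 * (4 * k / n) * F (n - d))) / 2 := by
      have e1 : Real.exp (4 * k * ((F d + F (n - d)) / n)) =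
          Real.exp (4 * k / n * F d) * Real.exp (4 * k / n * F (n - d)) := by
        rw [← Real.exp_add]; congr 1; ring
      have e2 (x : ℝ) : Real.exp (2 * (4 * k / n) * x) = Real.exp (4 * k / n * x) ^ 2 := by
        rw [← Real.exp_nat_mul]; congr 1; push_cast; ring
      rw [e1, e2, e2]
      nlinarith [sq_nonneg (Real.exp (4 * k / n * F d) - Real.exp (4 * k / n * F (n - d)))]
    have h2 : ∑ d ∈ Finset.range n, Real.exp (2 * (4 * k / n) * F (n - d)) ≤
        ∑ d ∈ Finset.range n, Real.exp (2 * (4 * k / n) * F d) := by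
      rw [← Finset.sum_range_reflect]
      refine Finset.sum_le_sum fun d hd => ?_
      rw [Finset.mem_range] at hd
      gcongr
      exact hFanti _ _ (by omega)
    have h3 := Finset.sum_le_sum fun d (_ : d ∈ Finset.range n) => h1 d
    rw [← Finset.sum_div, Finset.sum_add_distrib] at h3
    linarith
  rw [sub_le_iff_le_add, div_le_iff₀ hn0]
  refine (hsym.trans hsum).trans ?_
  have : n * (n : ℝ) ^ (-(1 / 4) : ℝ) ≤ n * (ε / 2) := by gcongr
  nlinarith

end IsLogSpreadTail

/-! ### Limits in distribution from tail bounds -/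

lemma ofReal_le_of_real_le {Ω : Type*} [MeasurableSpace Ω] {P : Measure Ω} [IsProbabilityMeasure P]
    {s : Set Ω} {x : ℝ} (h : P.real s ≤ x) : P s ≤ ENNReal.ofReal x := by
  rw [← ofReal_measureReal]; exact ENNReal.ofReal_le_ofReal h

/-- The tail bounds that give compactly supported, non-degenerate limits. In the application
`b n k` and `c n k` are the probabilities that the first `k` objects do not, respectively do,
cover the circle, and the summands `8 / t` come from the fluctuations of the Poisson clock. -/
lemma compactSupportPhase_of_bounds {Ω : ℕ → Type*} [∀ n, MeasurableSpace (Ω n)]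
    (P : ∀ n, Measure (Ω n)) [∀ n, IsProbabilityMeasure (P n)] (f : ℝ → ℝ) (S : ∀ n, Ω n → ℝ)
    (b c : ℕ → ℕ → ℝ) (hf0 : ∀ n : ℕ, 1 ≤ n → 0 < f n) (hf1 : ∀ n : ℕ, 1 ≤ n → f n ≤ 1)
    (hf : Tendsto (fun n : ℕ => f n) atTop (𝓝 0))
    (hS : ∀ n, 1 ≤ n → AEMeasurable (S n) (P n)) (hS0 : ∀ n ω, 0 ≤ S n ω)
    (hup : ∀ n, 1 ≤ n → ∀ t : ℝ, 0 < t → (P n).real {ω | t < S n ω} ≤ 8 / t + b n ⌊t / 2⌋₊)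
    (hlow : ∀ n, 1 ≤ n → ∀ t : ℝ, 0 < t → (P n).real {ω | S n ω < t} ≤ 8 / t + c n ⌊2 * t⌋₊)
    (hb : ∀ n, 1 ≤ n → ∀ k : ℕ, b n k ≤ Real.exp (-(k * f n)))
    (hb' : ∀ ε > 0, ∀ᶠ n : ℕ in atTop, ∀ k : ℕ, 16 ≤ k * f n → b n k ≤ ε)
    (hc : ∀ ε > 0, ∃ α > 0, ∀ᶠ n : ℕ in atTop, ∀ k : ℕ, k * f n ≤ α → c n k ≤ ε) :
    CompactSupportPhase P f S := by
  have hset (n : ℕ) (hn : 1 ≤ n) (M : ℝ) : {ω | M < f n * S n ω} = {ω | M / f n < S n ω} := by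
    ext ω; simp only [mem_ofPred_eq, div_lt_iff₀' (hf0 n hn)]
  have hset' (n : ℕ) (hn : 1 ≤ n) (M : ℝ) : {ω | f n * S n ω < M} = {ω | S n ω < M / f n} := by
    ext ω; simp only [mem_ofPred_eq, lt_div_iff₀' (hf0 n hn)]
  have hfloor (n : ℕ) (hn : 1 ≤ n) (M : ℝ) : M / 2 - f n ≤ ⌊M / f n / 2⌋₊ * f n := by
    have h1 := Nat.lt_floor_add_one (M / f n / 2)
    have h2 := mul_lt_mul_of_pos_right h1 (hf0 n hn)
    have h3 : M / f n / 2 * f n = M / 2 := by have := (hf0 n hn).ne'; field_simp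
    linarith
  have hupper (n : ℕ) (hn : 1 ≤ n) (M : ℝ) (hM : 0 < M) : (P n).real {ω | M < f n * S n ω} ≤
      8 * f n / M + Real.exp (-(M / 2 - f n)) := by
    have h1 := hup n hn (M / f n) (div_pos hM (hf0 n hn))
    rw [hset n hn]
    refine h1.trans (add_le_add (by rw [div_div_eq_mul_div]) ((hb n hn _).trans ?_))
    rw [Real.exp_le_exp]
    linarith [hfloor n hn M]
  have hlim (M : ℝ) : Tendsto (fun n : ℕ => 8 * f n / M) atTop (𝓝 0) := by
    simpa using (hf.const_mul 8).div_const M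
  -- `⌊36 / f n / 2⌋ * f n ≥ 18 - f n ≥ 16`, so `hb'` applies at the time `36 / f n`
  have hbound : ∀ ε > 0, ∀ᶠ n : ℕ in atTop, (P n).real {ω | 36 < f n * S n ω} ≤ ε := by
    intro ε hε
    filter_upwards [eventually_ge_atTop 1, hb' (ε / 2) (half_pos hε),
      (hlim 36).eventually_le_const (half_pos hε)] with n hn h1 h2
    have h3 := hup n hn (36 / f n) (div_pos (by norm_num) (hf0 n hn))
    rw [hset n hn]
    rw [div_div_eq_mul_div] at h3
    have h4 := hfloor n hn 36
    have := h1 ⌊(36 : ℝ) / f n / 2⌋₊ (by linarith [hf1 n hn])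
    linarith
  have hlower : ∀ ε > 0, ∃ α > 0, ∀ᶠ n : ℕ in atTop, (P n).real {ω | f n * S n ω < α} ≤ ε := by
    intro ε hε
    obtain ⟨α, hα, h1⟩ := hc (ε / 2) (half_pos hε)
    refine ⟨α / 2, half_pos hα, ?_⟩
    filter_upwards [eventually_ge_atTop 1, h1, (hlim (α / 2)).eventually_le_const (half_pos hε)]
      with n hn h1 h2
    have h3 := hlow n hn (α / 2 / f n) (div_pos (half_pos hα) (hf0 n hn))
    rw [hset' n hn]
    rw [div_div_eq_mul_div 8] at h3
    have h4 : ⌊2 * (α / 2 / f n)⌋₊ * f n ≤ α := by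
      have h5 : 0 ≤ 2 * (α / 2 / f n) := by have := hf0 n hn; positivity
      calc _ ≤ 2 * (α / 2 / f n) * f n :=
            mul_le_mul_of_nonneg_right (Nat.floor_le h5) (hf0 n hn).le
        _ = α := by have := (hf0 n hn).ne'; field_simp
    linarith [h1 _ h4]
  refine ⟨hS, ?_, ?_, ?_⟩
  · rw [isTightMeasureSet_iff_exists_isCompact_measure_compl_le]
    intro ε hε
    have h1 : Tendsto (fun M : ℝ => ENNReal.ofReal (8 / M + Real.exp (-(M / 2 - 1)))) atTop
        (𝓝 0) := by
      rw [← ENNReal.ofReal_zero]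
      refine ENNReal.tendsto_ofReal ?_
      rw [← add_zero (0 : ℝ)]
      refine (tendsto_const_nhds.div_atTop tendsto_id).add
        (Real.tendsto_exp_neg_atTop_nhds_zero.comp ?_)
      exact tendsto_atTop_add_const_right _ _ (tendsto_id.atTop_div_const (by norm_num))
    obtain ⟨M, hM, hM0⟩ := ((h1.eventually_le_const hε).and (eventually_gt_atTop 0)).exists
    refine ⟨Icc 0 M, isCompact_Icc, ?_⟩
    rintro μ ⟨n, hn, rfl⟩
    rw [Measure.map_apply_of_aemeasurable ((hS n hn).const_mul _) measurableSet_Icc.compl]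
    refine le_trans (measure_mono ?_) ((ofReal_le_of_real_le (hupper n hn M hM0)).trans
      ((ENNReal.ofReal_le_ofReal ?_).trans hM))
    · intro ω hω
      by_contra hc
      exact hω ⟨mul_nonneg (hf0 n hn).le (hS0 n ω), not_lt.1 hc⟩
    · have := hf1 n hn
      gcongr
      linarith
  · intro m hm hm1 ν _ hν
    have hopen (G : Set ℝ) (hG : IsOpen G) (ε : ℝ)
        (h : ∀ᶠ n in atTop, (P n).real {ω | f n * S n ω ∈ G} ≤ ε) : ν G ≤ ENNReal.ofReal ε := by
      have h1 := ProbabilityMeasure.le_liminf_measure_open_of_tendsto hν.tendsto hG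
      simp only [ProbabilityMeasure.coe_mk, Measure.map_id] at h1
      refine h1.trans (liminf_le_of_frequently_le' (Eventually.frequently ?_))
      filter_upwards [hm.tendsto_atTop.eventually h] with k hk
      rw [Measure.map_apply_of_aemeasurable (hν.forall_aemeasurable k) hG.measurableSet]
      exact ofReal_le_of_real_le hk
    have hzero (G : Set ℝ) (hG : IsOpen G)
        (h : ∀ ε > 0, ∀ᶠ n in atTop, (P n).real {ω | f n * S n ω ∈ G} ≤ ε) : ν G = 0 := by
      refine le_antisymm (ENNReal.le_of_forall_pos_le_add fun ε hε _ => ?_) (zero_le)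
      simpa using hopen G hG ε (h ε hε)
    have hpos : ν (Iio 0) = 0 := by
      refine hzero _ isOpen_Iio fun ε hε => ?_
      filter_upwards [eventually_ge_atTop 1] with n hn
      have : {ω | f n * S n ω ∈ Iio (0 : ℝ)} = ∅ := by
        ext ω
        simpa using mul_nonneg (hf0 n hn).le (hS0 n ω)
      rw [this]; simpa using hε.le
    have hbdd : ν (Ioi 36) = 0 := hzero _ isOpen_Ioi hbound
    have hatom : ν {0} = 0 := by
      refine le_antisymm (ENNReal.le_of_forall_pos_le_add fun ε hε _ => ?_) (zero_le)
      obtain ⟨α, hα, h1⟩ := hlower ε hε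
      have h2 : ν {0} ≤ ν (Iio α) := measure_mono (by simpa using hα)
      simpa using h2.trans (hopen _ isOpen_Iio _ h1)
    refine ⟨?_, ?_, hatom⟩
    · rintro ⟨x, rfl⟩
      rcases lt_trichotomy x 0 with hx | hx | hx
      · simp [hx] at hpos
      · simp [hx] at hatom
      -- the limit gives `Ioi (x / 2)` mass less than one
      · have he : Real.exp (-(x / 4)) < 1 := by
          rw [← Real.exp_zero, Real.exp_lt_exp]; linarith
        have h1 : Real.exp (-(x / 4)) < (1 + Real.exp (-(x / 4))) / 2 := by linarith
        have h2 : Tendsto (fun n : ℕ => 8 * f n / (x / 2) + Real.exp (-(x / 2 / 2 - f n))) atTop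
            (𝓝 (0 + Real.exp (-(x / 4)))) := by
          refine (hlim _).add ((Real.continuous_exp.tendsto _).comp ?_)
          have := (hf.const_sub (x / 2 / 2)).neg
          convert this using 2; ring
        have h3 := hopen (Ioi (x / 2)) isOpen_Ioi ((1 + Real.exp (-(x / 4))) / 2) (by
          filter_upwards [eventually_ge_atTop 1, h2.eventually_le_const (by simpa using h1)]
            with n hn h4
          exact (hupper n hn _ (half_pos hx)).trans h4)
        rw [Measure.dirac_apply' _ measurableSet_Ioi, indicator_of_mem (by simpa using hx),
          Pi.one_apply, ENNReal.one_le_ofReal] at h3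
        linarith
    · refine isCompact_Icc.of_isClosed_subset Measure.isClosed_support
        (Measure.support_subset_of_isClosed (isClosed_Icc (a := (0 : ℝ)) (b := 36)) ?_)
      rw [mem_ae_iff]
      have : (Icc (0 : ℝ) 36)ᶜ ⊆ Iio 0 ∪ Ioi 36 := by
        intro y hy
        by_contra h
        simp only [mem_union, mem_Iio, mem_Ioi, not_or, not_lt] at h
        exact hy h
      exact measure_mono_null this (measure_union_null hpos hbdd)
  · rw [ENNReal.tendsto_nhds_zero]
    intro ε hε
    obtain ⟨δ, hδ, hδε⟩ : ∃ δ : ℝ, 0 < δ ∧ ENNReal.ofReal δ ≤ ε := by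
      have h1 : Tendsto (fun δ : ℝ => ENNReal.ofReal δ) (𝓝[>] 0) (𝓝 0) := by
        rw [← ENNReal.ofReal_zero]
        exact ENNReal.tendsto_ofReal (tendsto_id.mono_left nhdsWithin_le_nhds)
      obtain ⟨δ, h2, h3⟩ := ((h1.eventually_le_const hε).and self_mem_nhdsWithin).exists
      exact ⟨δ, h3, h2⟩
    obtain ⟨α, hα, h1⟩ := hlower δ hδ
    filter_upwards [Ioo_mem_nhdsGT hα] with β hβ
    refine (limsup_le_of_le (by isBoundedDefault) ?_).trans hδε
    filter_upwards [h1] with n hn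
    refine (measure_mono ?_).trans (ofReal_le_of_real_le hn)
    intro ω (hω : _ < β)
    exact hω.trans hβ.2

/-! ### Concentration of the Poisson clock -/

/-- The probability generating function of the Poisson law. -/
lemma integral_pow_poissonMeasure (r : ℝ≥0) {c : ℝ} (hc : 0 ≤ c) :
    Integrable (fun k : ℕ => c ^ k) (poissonMeasure r) ∧
      ∫ k, c ^ k ∂(poissonMeasure r) = Real.exp ((c - 1) * r) := by
  have h1 : HasSum (fun k : ℕ => Real.exp (-r) * r ^ k / k.factorial * c ^ k)
      (Real.exp ((c - 1) * r)) := by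
    have h2 := (NormedSpace.expSeries_div_hasSum_exp (c * r : ℝ)).mul_left (Real.exp (-r))
    rw [← Real.exp_eq_exp_ℝ, ← Real.exp_add] at h2
    have h4 : (c - 1) * r = -r + c * r := by ring
    rw [h4]
    refine h2.congr_fun fun k => ?_
    rw [mul_pow]; ring
  have h3 : Integrable (fun k : ℕ => c ^ k) (poissonMeasure r) := by
    rw [integrable_poissonMeasure_iff]
    convert h1.summable using 2 with k
    simp [abs_of_nonneg hc]
  exact ⟨h3, by rw [integral_poissonMeasure]; simpa using h1.tsum_eq⟩

namespace IsPoissonProcess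

variable {Ω : Type*} [MeasurableSpace Ω] {P : Measure Ω} {N : ℝ≥0 → Ω → ℕ}

lemma hasLaw (h : IsPoissonProcess P N) (t : ℝ≥0) : HasLaw (N t) (poissonMeasure t) P := by
  simpa [h.zero] using h.law 0 t (zero_le)

lemma prob_pow_ge_le (h : IsPoissonProcess P N) (t : ℝ≥0) {c x : ℝ} (hc : 0 ≤ c) (hx : 0 < x) :
    P.real {ω | x ≤ c ^ N t ω} ≤ Real.exp ((c - 1) * t) / x := by
  obtain ⟨h1, h2⟩ := integral_pow_poissonMeasure t hc
  have hl := h.hasLaw t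
  have h3 := mul_meas_ge_le_integral_of_nonneg (ae_of_all _ fun k => pow_nonneg hc k) h1 x
  rw [h2] at h3
  have h4 : P.real {ω | x ≤ c ^ N t ω} = (poissonMeasure t).real {k | x ≤ c ^ k} :=
    hl.measureReal_eq (p := fun k => x ≤ c ^ k) .of_discrete
  rw [h4, le_div_iff₀' hx]
  exact h3

/-- Chernoff's bound, weakened to a polynomial one. -/
lemma prob_le_half (h : IsPoissonProcess P N) {t : ℝ≥0} (ht : 0 < t) :
    P.real {ω | (N t ω : ℝ) ≤ t / 2} ≤ 8 / t := by
  have ht' : (0 : ℝ) < t := ht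
  have h1 := h.prob_pow_ge_le t (c := 1 / 2) (x := (1 / 2 : ℝ) ^ ((t : ℝ) / 2)) (by norm_num)
    (by positivity)
  have h2 : {ω | (N t ω : ℝ) ≤ t / 2} = {ω | (1 / 2 : ℝ) ^ ((t : ℝ) / 2) ≤ (1 / 2) ^ N t ω} := by
    ext ω
    simp only [mem_ofPred_eq]
    rw [← Real.rpow_natCast, Real.rpow_le_rpow_left_iff_of_base_lt_one (by norm_num) (by norm_num)]
  rw [h2]
  refine h1.trans ?_
  rw [Real.rpow_def_of_pos (by norm_num), ← Real.exp_sub]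
  have h3 : Real.log (1 / 2) = -Real.log 2 := by rw [one_div, Real.log_inv]
  have h4 := Real.log_two_lt_d9
  have h5 : (1 / 2 - 1) * (t : ℝ) - Real.log (1 / 2) * (t / 2) ≤ -(t / 8) := by
    rw [h3]; nlinarith
  refine (Real.exp_le_exp.2 h5).trans ?_
  rw [Real.exp_neg, inv_le_comm₀ (Real.exp_pos _) (by positivity), inv_div]
  linarith [Real.add_one_le_exp ((t : ℝ) / 8)]

/-- Chernoff's bound, weakened to a polynomial one. -/
lemma prob_ge_two_mul (h : IsPoissonProcess P N) {t : ℝ≥0} (ht : 0 < t) :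
    P.real {ω | 2 * (t : ℝ) ≤ N t ω} ≤ 8 / t := by
  have ht' : (0 : ℝ) < t := ht
  have h1 := h.prob_pow_ge_le t (c := 2) (x := (2 : ℝ) ^ (2 * (t : ℝ))) (by norm_num)
    (by positivity)
  have h2 : {ω | 2 * (t : ℝ) ≤ N t ω} = {ω | (2 : ℝ) ^ (2 * (t : ℝ)) ≤ 2 ^ N t ω} := by
    ext ω
    simp only [mem_ofPred_eq]
    rw [← Real.rpow_natCast 2 (N t ω), Real.rpow_le_rpow_left_iff (by norm_num)]
  rw [h2]
  refine h1.trans ?_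
  rw [Real.rpow_def_of_pos (by norm_num), ← Real.exp_sub]
  have h4 := Real.log_two_gt_d9
  have h5 : (2 - 1) * (t : ℝ) - Real.log 2 * (2 * t) ≤ -(t / 8) := by nlinarith
  refine (Real.exp_le_exp.2 h5).trans ?_
  rw [Real.exp_neg, inv_le_comm₀ (Real.exp_pos _) (by positivity), inv_div]
  linarith [Real.add_one_le_exp ((t : ℝ) / 8)]

end IsPoissonProcess

/-! ### The cover times -/

section Times

variable {Ω : Type*} {n : ℕ} {R : ℕ → Ω → ℕ} {U : ℕ → Ω → ZMod n} {N : ℝ≥0 → Ω → ℕ}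

lemma coveredAt_eq_univ_of_le {ω : Ω} (hN : Monotone fun t => N t ω) {s t : ℝ≥0} (hst : s ≤ t)
    (h : coveredAt R U N s ω = univ) : coveredAt R U N t ω = univ :=
  covered_eq_univ_of_le (hN hst) h

lemma covered_floor_ne_univ_of_lt {ω : Ω} {t : ℝ} (ht : 0 ≤ t)
    (h : t < discreteCoverTime R U ω) : covered R U ⌊t⌋₊ ω ≠ univ := by
  intro hc
  have h1 : sInf {k : ℕ | covered R U k ω = univ} ≤ ⌊t⌋₊ := Nat.sInf_le hc
  have h2 : discreteCoverTime R U ω ≤ t := (Nat.cast_le.2 h1).trans (Nat.floor_le ht)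
  linarith

lemma covered_floor_eq_univ_of_lt {ω : Ω} {t : ℝ} (hfin : ∃ k, covered R U k ω = univ)
    (h : discreteCoverTime R U ω < t) : covered R U ⌊t⌋₊ ω = univ :=
  covered_eq_univ_of_le (Nat.le_floor h.le) (Nat.sInf_mem hfin)

lemma coveredAt_ne_univ_of_lt {ω : Ω} {t : ℝ≥0} (h : t < coverTime R U N ω) :
    coveredAt R U N t ω ≠ univ := by
  intro hc
  have h1 : sInf {t : ℝ≥0 | coveredAt R U N t ω = univ} ≤ t := csInf_le (OrderBot.bddBelow _) hc
  exact h.not_ge (NNReal.coe_le_coe.2 h1)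

lemma coveredAt_eq_univ_of_lt {ω : Ω} (hN : Monotone fun t => N t ω) {t : ℝ≥0}
    (hfin : ∃ t, coveredAt R U N t ω = univ) (h : coverTime R U N ω < t) :
    coveredAt R U N t ω = univ := by
  obtain ⟨s, hs, hst⟩ := exists_lt_of_csInf_lt hfin (NNReal.coe_lt_coe.1 h)
  exact coveredAt_eq_univ_of_le hN hst.le hs

variable [MeasurableSpace Ω] {P : Measure Ω} {f : ℝ → ℝ}

lemma prob_lt_discreteCoverTime_le [IsFiniteMeasure P] {t : ℝ} (ht : 0 < t) :
    P.real {ω | t < discreteCoverTime R U ω} ≤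
      8 / t + P.real {ω | covered R U ⌊t / 2⌋₊ ω ≠ univ} := by
  have h1 : (0 : ℝ) ≤ 8 / t := by positivity
  refine (measureReal_mono fun ω hω hc => ?_).trans (le_add_of_nonneg_left h1)
  exact covered_floor_ne_univ_of_lt ht.le hω
    (covered_eq_univ_of_le (Nat.floor_le_floor (by linarith)) hc)

namespace IsCoveringModel

/-- Up to time `t` at least `t / 2` objects arrive, unless the clock is unusually slow. -/
lemma prob_not_coveredAt_le [IsFiniteMeasure P] (h : IsCoveringModel f n P R U N)
    {t : ℝ≥0} (ht : 0 < t) :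
    P.real {ω | coveredAt R U N t ω ≠ univ} ≤
      8 / t + P.real {ω | covered R U ⌊(t : ℝ) / 2⌋₊ ω ≠ univ} := by
  refine le_trans (measureReal_mono ?_) ((measureReal_union_le _ _).trans
    (add_le_add_left (h.poisson.prob_le_half ht) _))
  intro ω hω
  by_cases hN : (N t ω : ℝ) ≤ t / 2
  · exact .inl hN
  · exact .inr fun hc => hω (covered_eq_univ_of_le (Nat.floor_le_of_le (not_le.1 hN).le) hc)

/-- Up to time `t` at most `2 * t` objects arrive, unless the clock is unusually fast. -/
lemma prob_coveredAt_le [IsFiniteMeasure P] (h : IsCoveringModel f n P R U N)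
    {t : ℝ≥0} (ht : 0 < t) :
    P.real {ω | coveredAt R U N t ω = univ} ≤
      8 / t + P.real {ω | covered R U ⌊2 * (t : ℝ)⌋₊ ω = univ} := by
  refine le_trans (measureReal_mono ?_) ((measureReal_union_le _ _).trans
    (add_le_add_left (h.poisson.prob_ge_two_mul ht) _))
  intro ω hω
  by_cases hN : 2 * (t : ℝ) ≤ N t ω
  · exact .inl hN
  · exact .inr (covered_eq_univ_of_le (Nat.le_floor (not_le.1 hN).le) hω)

lemma prob_lt_coverTime_le [IsFiniteMeasure P] (h : IsCoveringModel f n P R U N)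
    {t : ℝ} (ht : 0 < t) :
    P.real {ω | t < coverTime R U N ω} ≤
      8 / t + P.real {ω | covered R U ⌊t / 2⌋₊ ω ≠ univ} := by
  lift t to ℝ≥0 using ht.le
  exact (measureReal_mono fun ω hω => coveredAt_ne_univ_of_lt hω).trans
    (h.prob_not_coveredAt_le ht)

variable [NeZero n]

lemma measurable_discreteCoverTime (h : IsCoveringModel f n P R U N) :
    Measurable (discreteCoverTime R U) := by
  refine measurable_from_nat.comp (measurable_of_Iic fun k => ?_)
  have : (fun ω => sInf {k : ℕ | covered R U k ω = univ}) ⁻¹' Iic k =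
      {ω | covered R U k ω = univ} ∪ ⋂ j, {ω | covered R U j ω = univ}ᶜ := by
    ext ω
    simp only [mem_preimage, mem_Iic, mem_union, mem_ofPred_eq, mem_iInter, mem_compl_iff]
    constructor
    · intro hk
      by_cases hfin : ∃ j, covered R U j ω = univ
      · exact .inl (covered_eq_univ_of_le hk (Nat.sInf_mem hfin))
      · exact .inr (not_exists.1 hfin)
    · rintro (hk | hk)
      · exact Nat.sInf_le hk
      · have : {k | covered R U k ω = univ} = ∅ := eq_empty_of_forall_notMem hk
        simp [this]
  rw [this]
  exact (h.measurableSet_covered_eq_univ k).union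
    (.iInter fun j => (h.measurableSet_covered_eq_univ j).compl)

lemma measurableSet_coveredAt_eq_univ (h : IsCoveringModel f n P R U N) (t : ℝ≥0) :
    MeasurableSet {ω | coveredAt R U N t ω = univ} := by
  have : {ω | coveredAt R U N t ω = univ} =
      ⋃ k, N t ⁻¹' {k} ∩ {ω | covered R U k ω = univ} := by
    ext ω; simp [coveredAt]
  rw [this]
  exact .iUnion fun k => (h.poisson.measurable t (measurableSet_singleton k)).inter
    (h.measurableSet_covered_eq_univ k)

lemma measurable_coverTime (h : IsCoveringModel f n P R U N) : Measurable (coverTime R U N) := by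
  refine measurable_coe_nnreal_real.comp (measurable_of_Iio fun t => ?_)
  -- by monotonicity, countably many times decide whether the circle is ever covered before `t`
  have : (fun ω => sInf {t : ℝ≥0 | coveredAt R U N t ω = univ}) ⁻¹' Iio t =
      (⋃ i : ℕ, {ω | TopologicalSpace.denseSeq ℝ≥0 i < t ∧
        coveredAt R U N (TopologicalSpace.denseSeq ℝ≥0 i) ω = univ}) ∪
      ⋂ i : ℕ, {ω | 0 < t ∧ coveredAt R U N i ω ≠ univ} := by
    ext ω
    simp only [mem_preimage, mem_Iio, mem_union, mem_iUnion, mem_iInter, mem_ofPred_eq]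
    constructor
    · intro ht
      by_cases hfin : ∃ t, coveredAt R U N t ω = univ
      · obtain ⟨s, hs, hst⟩ := exists_lt_of_csInf_lt hfin ht
        obtain ⟨_, ⟨i, rfl⟩, hi⟩ :=
          (TopologicalSpace.denseRange_denseSeq ℝ≥0).exists_between hst
        exact .inl ⟨i, hi.2, coveredAt_eq_univ_of_le (h.poisson.mono ω) hi.1.le hs⟩
      · exact .inr fun i => ⟨(zero_le).trans_lt ht, not_exists.1 hfin i⟩
    · rintro (⟨i, hi, hc⟩ | hc)
      · exact lt_of_le_of_lt (csInf_le (OrderBot.bddBelow _) hc) hi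
      · have : {t : ℝ≥0 | coveredAt R U N t ω = univ} = ∅ := by
          refine eq_empty_of_forall_notMem fun s hs => ?_
          obtain ⟨i, hi⟩ := exists_nat_ge s
          exact (hc i).2 (coveredAt_eq_univ_of_le (h.poisson.mono ω) hi hs)
        rw [this, NNReal.sInf_empty]
        exact (hc 0).1
  rw [this]
  refine .union (.iUnion fun i => ?_) (.iInter fun i => ?_)
  · exact (MeasurableSet.const _).inter (h.measurableSet_coveredAt_eq_univ _)
  · exact (MeasurableSet.const _).inter (h.measurableSet_coveredAt_eq_univ _).compl

variable [IsProbabilityMeasure P]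

/-- Every site is eventually chosen as the position of an object, and the clock runs forever. -/
lemma ae_exists_coveredAt (h : IsCoveringModel f n P R U N) :
    ∀ᵐ ω ∂P, ∃ t : ℝ≥0, coveredAt R U N t ω = univ := by
  have hn : (0 : ℝ) < n := by exact_mod_cast NeZero.pos n
  set q : ℝ := (∑ j ∈ Finset.range n, f ((j + 1 : ℕ))) / n with hq
  have hq0 : 0 < q := by
    refine div_pos (Finset.sum_pos' (fun j _ => h.tail_nonneg (by omega))
      ⟨0, by simpa using NeZero.pos n, ?_⟩) hn
    rw [zero_add, h.tail_one]; exact one_pos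
  have hb (t : ℕ) : P.real {ω | ¬ ∃ t : ℝ≥0, coveredAt R U N t ω = univ} ≤
      8 / ((t + 1 : ℕ) : ℝ) + ((n / 1 : ℕ) + 1) * Real.exp (-(⌊((t + 1 : ℕ) : ℝ) / 2⌋₊ * q)) := by
    have h1 := h.prob_not_coveredAt_le (t := (t + 1 : ℕ)) (by positivity)
    rw [NNReal.coe_natCast] at h1
    have h2 := h.prob_not_covered_le_blocks (m := 1) le_rfl ⌊((t + 1 : ℕ) : ℝ) / 2⌋₊
    refine le_trans (measureReal_mono fun ω hω => ?_) (h1.trans (add_le_add_right h2 _))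
    exact not_exists.1 hω _
  have hlim : Tendsto (fun t : ℕ => 8 / ((t + 1 : ℕ) : ℝ) +
      ((n / 1 : ℕ) + 1) * Real.exp (-(⌊((t + 1 : ℕ) : ℝ) / 2⌋₊ * q))) atTop
        (𝓝 (0 + ((n / 1 : ℕ) + 1) * 0)) := by
    have ht : Tendsto (fun t : ℕ => ((t + 1 : ℕ) : ℝ)) atTop atTop :=
      tendsto_natCast_atTop_atTop.comp (tendsto_add_atTop_nat 1)
    refine (tendsto_const_nhds.div_atTop ht).add
      (.const_mul _ (Real.tendsto_exp_neg_atTop_nhds_zero.comp ?_))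
    exact (tendsto_natCast_atTop_atTop.comp (tendsto_nat_floor_atTop.comp
      (ht.atTop_div_const (by norm_num)))).atTop_mul_const hq0
  have h0 := ge_of_tendsto' hlim hb
  rw [mul_zero, add_zero] at h0
  rw [ae_iff, ← measureReal_eq_zero_iff]
  exact le_antisymm h0 measureReal_nonneg

lemma prob_discreteCoverTime_lt_le (h : IsCoveringModel f n P R U N) {t : ℝ} (ht : 0 < t) :
    P.real {ω | discreteCoverTime R U ω < t} ≤
      8 / t + P.real {ω | covered R U ⌊2 * t⌋₊ ω = univ} := by
  have h1 : (0 : ℝ) ≤ 8 / t := by positivity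
  refine (ENNReal.toReal_mono (measure_ne_top _ _) (measure_mono_ae ?_)).trans
    (le_add_of_nonneg_left h1)
  filter_upwards [h.ae_exists_coveredAt] with ω ⟨s, hs⟩ hω
  exact covered_floor_eq_univ_of_lt ⟨_, hs⟩ (lt_trans hω (by linarith))

lemma prob_coverTime_lt_le (h : IsCoveringModel f n P R U N) {t : ℝ} (ht : 0 < t) :
    P.real {ω | coverTime R U N ω < t} ≤
      8 / t + P.real {ω | covered R U ⌊2 * t⌋₊ ω = univ} := by
  lift t to ℝ≥0 using ht.le
  refine (ENNReal.toReal_mono (measure_ne_top _ _) (measure_mono_ae ?_)).trans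
    (h.prob_coveredAt_le ht)
  filter_upwards [h.ae_exists_coveredAt] with ω hfin hω
  exact coveredAt_eq_univ_of_lt (h.poisson.mono ω) hfin hω

end IsCoveringModel

end Times

/-! ### The two families of tails -/

lemma IsRegularlyVarying.isLogSpreadTail {f : ℝ → ℝ} (hf : IsRegularlyVarying f (-1))
    (hu : UniformBound f) (hp : PartialSumBound f) (h0 : ∀ r : ℕ, 1 ≤ r → 0 ≤ f r) :
    IsLogSpreadTail (fun r => f r) := by
  -- a quotient `f n / f n` close to `1` excludes `f n = 0`, where it takes the value `0`
  have hpos : ∀ᶠ n : ℕ in atTop, 0 < f n := by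
    have h1 := (hf.tendsto 1 one_pos).comp tendsto_natCast_atTop_atTop
    rw [Real.one_rpow] at h1
    filter_upwards [h1.eventually_const_lt one_half_lt_one, eventually_ge_atTop 1] with n hn hn1
    refine lt_of_le_of_ne (h0 n hn1) fun h => ?_
    simp only [Function.comp_apply, ← h, div_zero] at hn
    linarith
  refine ⟨hpos, fun j => ?_, ?_, ?_⟩
  · have h1 := (hf.tendsto (2 ^ j) (by positivity)).comp tendsto_natCast_atTop_atTop
    have hj : (0 : ℝ) < (2 ^ j : ℝ)⁻¹ := by positivity
    rw [Real.rpow_neg_one] at h1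
    filter_upwards [h1.eventually_le_const (show (2 ^ j : ℝ)⁻¹ < 2 * (2 ^ j : ℝ)⁻¹ by linarith),
      hpos] with m hm hm0
    simp only [Function.comp_apply] at hm
    rw [div_le_iff₀ hm0] at hm
    push_cast
    rw [mul_comm _ (m : ℝ)]
    calc _ ≤ 2 ^ j * (2 * (2 ^ j : ℝ)⁻¹ * f m) := by gcongr
      _ = 2 * f m := by field_simp
  · obtain ⟨c, hc, hctop⟩ := exists_between (hu (1 / 2) (by norm_num) (by norm_num))
    refine ⟨c.toReal, ?_⟩
    filter_upwards [eventually_lt_of_limsup_lt hc, hpos, eventually_ge_atTop 1]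
      with n hn hn0 hn1 i hi hin
    have hn2 : (0 : ℝ) < n := by exact_mod_cast hn1
    have h1 : ENNReal.ofReal (i * f i / (n * f n)) ≤ c :=
      (le_iSup₂_of_le (i : ℝ) ⟨by rwa [← Real.sqrt_eq_rpow], by exact_mod_cast hin⟩ le_rfl).trans
        hn.le
    rw [ENNReal.ofReal_le_iff_le_toReal hctop.ne, div_le_iff₀ (by positivity)] at h1
    exact h1
  · obtain ⟨c, hc, hctop⟩ := exists_between (hp (1 / 2) (by norm_num) (by norm_num))
    refine ⟨c.toReal, ?_⟩
    filter_upwards [eventually_lt_of_limsup_lt hc, hpos, eventually_ge_atTop 2]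
      with n hn hn0 hn1
    have hn2 : (0 : ℝ) < n := by
      have : 0 < n := by omega
      exact_mod_cast this
    have hl : 0 < Real.log n := Real.log_pos (by exact_mod_cast hn1)
    have h1 := hn.le
    rw [ENNReal.ofReal_le_iff_le_toReal hctop.ne, div_le_iff₀ (by positivity),
      ← Real.sqrt_eq_rpow] at h1
    linarith

/-- A sum is controlled by a function whose increments dominate its terms from `r` on. -/
lemma sum_Icc_le_of_le_sub {a : ℕ → ℝ} {G : ℕ → ℝ} {r n : ℕ} (hG : 0 ≤ G r)
    (h : ∀ m, r ≤ m → m < n → a (m + 1) ≤ G (m + 1) - G m) {m : ℕ} (hrm : r ≤ m) (hmn : m ≤ n) :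
    ∑ i ∈ Finset.Icc 1 m, a i ≤ ∑ i ∈ Finset.Icc 1 r, a i + G m := by
  induction m, hrm using Nat.le_induction with
  | base => linarith
  | succ m hm ih =>
    rw [Finset.sum_Icc_succ_top (by omega)]
    linarith [ih (by omega), h m hm (by omega)]

lemma inv_succ_le_log_sub_log {m : ℕ} (hm : 1 ≤ m) :
    ((m + 1 : ℕ) : ℝ)⁻¹ ≤ Real.log (m + 1 : ℕ) - Real.log m := by
  have h := sum_Ico_inv_le_log hm (Nat.le_succ m)
  rw [Nat.Ico_succ_singleton, Finset.sum_singleton,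
    Real.log_div (by positivity) (by positivity)] at h
  simpa using h

/-- Comparison with the increments of `log ^ (b + 1)`, by concavity. -/
lemma log_rpow_div_le {b : ℝ} (hb : -1 < b) (hb0 : b < 0) {m : ℕ} (hm : 2 ≤ m) :
    Real.log (m + 1 : ℕ) ^ b / (m + 1 : ℕ) ≤
      Real.log (m + 1 : ℕ) ^ (b + 1) / (b + 1) - Real.log m ^ (b + 1) / (b + 1) := by
  set u := Real.log m with hu
  set v := Real.log (m + 1 : ℕ) with hv
  have hu0 : 0 < u := Real.log_pos (by exact_mod_cast hm)
  have h1 := inv_succ_le_log_sub_log (show 1 ≤ m by omega)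
  rw [← hu, ← hv] at h1
  have hv0 : 0 < v := by
    have : (0 : ℝ) < ((m + 1 : ℕ) : ℝ)⁻¹ := by positivity
    linarith
  have h2 := Real.geom_mean_le_arith_mean2_weighted (show 0 ≤ b + 1 by linarith)
    (show 0 ≤ -b by linarith) (show 0 ≤ u / v by positivity) zero_le_one (by ring)
  rw [Real.one_rpow, mul_one, Real.div_rpow hu0.le hv0.le, div_le_iff₀ (by positivity),
    Real.rpow_add_one hv0.ne'] at h2
  have h3 : ((b + 1) * (u / v) + -b * 1) * (v ^ b * v) =
      v ^ b * v - (b + 1) * (v ^ b * (v - u)) := by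
    field_simp; ring
  rw [h3] at h2
  have h4 : v ^ b * ((m + 1 : ℕ) : ℝ)⁻¹ ≤ v ^ b * (v - u) := by gcongr
  have hb1 : 0 < b + 1 := by linarith
  rw [← sub_div, div_eq_mul_inv, le_div_iff₀ hb1, Real.rpow_add_one hv0.ne']
  nlinarith

/-- The constant in `uniform` is `2 ^ (-b)` for `b < 0`, as `log i ≥ log n / 2` for `i ≥ √n`. The
partial sums are of order `log n ^ (b + 1)` because `b > -1`. -/
lemma isLogSpreadTail_of_eq_log_rpow {a : ℕ → ℝ} {b : ℝ} (hb : -1 < b)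
    (ha : ∀ᶠ r : ℕ in atTop, a r = Real.log r ^ b / r) : IsLogSpreadTail a := by
  obtain ⟨r₀, hr₀⟩ := eventually_atTop.1 (ha.and (eventually_ge_atTop 2))
  have hr2 : 2 ≤ r₀ := (hr₀ r₀ le_rfl).2
  have har (r : ℕ) (hr : r₀ ≤ r) : a r = Real.log r ^ b / r := (hr₀ r hr).1
  have hlog (r : ℕ) (hr : r₀ ≤ r) : 0 < Real.log r :=
    Real.log_pos (by exact_mod_cast hr2.trans hr)
  have hmul (r : ℕ) (hr : r₀ ≤ r) : r * a r = Real.log r ^ b := by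
    have : (r : ℝ) ≠ 0 := by
      have : r ≠ 0 := by omega
      exact_mod_cast this
    rw [har r hr]; field_simp
  have hsqrt : Tendsto (fun n : ℕ => √(n : ℝ)) atTop atTop :=
    Real.tendsto_sqrt_atTop.comp tendsto_natCast_atTop_atTop
  have hlogt : Tendsto (fun n : ℕ => Real.log n) atTop atTop :=
    Real.tendsto_log_atTop.comp tendsto_natCast_atTop_atTop
  refine ⟨?_, fun j => ?_, ?_, ?_⟩
  · filter_upwards [eventually_ge_atTop r₀] with r hr
    rw [har r hr]
    have := hlog r hr
    have : 0 < r := by omega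
    positivity
  · have h1 : Tendsto (fun m : ℕ => (1 + j * Real.log 2 / Real.log m) ^ b) atTop (𝓝 1) := by
      have h2 : Tendsto (fun m : ℕ => 1 + j * Real.log 2 / Real.log m) atTop (𝓝 (1 + 0)) :=
        tendsto_const_nhds.add (tendsto_const_nhds.div_atTop hlogt)
      rw [add_zero] at h2
      simpa using h2.rpow_const (p := b) (.inl one_ne_zero)
    filter_upwards [h1.eventually_le_const one_lt_two, eventually_ge_atTop r₀] with m hm hmr
    have hl := hlog m hmr
    have hm0 : (0 : ℝ) < m := by
      have : 0 < m := by omega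
      exact_mod_cast this
    have hmr' : r₀ ≤ 2 ^ j * m := hmr.trans (Nat.le_mul_of_pos_left _ (by positivity))
    have h3 : Real.log (2 ^ j * m : ℕ) = (1 + j * Real.log 2 / Real.log m) * Real.log m := by
      push_cast
      rw [Real.log_mul (by positivity) hm0.ne', Real.log_pow]
      field_simp
      ring
    have h4 : 0 ≤ 1 + j * Real.log 2 / Real.log m := by
      have := Real.log_pos one_lt_two
      positivity
    rw [har _ hmr', har m hmr, h3, Real.mul_rpow h4 hl.le]
    push_cast
    calc _ = (1 + j * Real.log 2 / Real.log m) ^ b * (Real.log m ^ b / m) := by field_simp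
      _ ≤ _ := by gcongr
  · refine ⟨max 1 (2 ^ (-b)), ?_⟩
    filter_upwards [hsqrt.eventually_ge_atTop (r₀ : ℝ), eventually_ge_atTop r₀]
      with n hn hnr i hi hin
    have hir : r₀ ≤ i := by exact_mod_cast hn.trans hi
    have hln := hlog n hnr
    have hli := hlog i hir
    have hi0 : (0 : ℝ) < i := by
      have : 0 < i := by omega
      exact_mod_cast this
    rw [hmul i hir, hmul n hnr]
    rcases le_or_gt 0 b with hb0 | hb0
    · calc _ ≤ Real.log n ^ b := by gcongr
        _ ≤ _ := le_mul_of_one_le_left (by positivity) (le_max_left _ _)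
    · have h1 : Real.log n / 2 ≤ Real.log i := by
        rw [← Real.log_sqrt (by positivity)]
        have : 0 < √(n : ℝ) := lt_of_lt_of_le (by positivity) hn
        exact Real.log_le_log this hi
      calc _ ≤ (Real.log n / 2) ^ b := Real.rpow_le_rpow_of_nonpos (by positivity) h1 hb0.le
        _ = 2 ^ (-b) * Real.log n ^ b := by
            rw [Real.div_rpow hln.le zero_le_two, Real.rpow_neg zero_le_two]; field_simp
        _ ≤ _ := by gcongr; exact le_max_right _ _
  · have hb1 : 0 < b + 1 := by linarith
    set C := ∑ i ∈ Finset.Icc 1 r₀, a i with hC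
    suffices h : ∃ D : ℝ, ∀ n : ℕ, r₀ ≤ n → ∀ m : ℕ, r₀ ≤ m → m ≤ n →
        ∑ i ∈ Finset.Icc 1 m, a i ≤ C + D * Real.log n ^ (b + 1) by
      obtain ⟨D, hD⟩ := h
      refine ⟨|C| + D, ?_⟩
      filter_upwards [hsqrt.eventually_ge_atTop (r₀ : ℝ), eventually_ge_atTop r₀,
        hlogt.eventually_ge_atTop 1] with n hn hnr hl
      have hn1 : (1 : ℝ) ≤ n := by
        have : 1 ≤ n := by omega
        exact_mod_cast this
      have h1 := hD n hnr ⌊√(n : ℝ)⌋₊ (Nat.le_floor hn)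
        (Nat.floor_le_of_le (Real.sqrt_le_self_iff.2 (.inr hn1)))
      rw [hmul n hnr, ← Real.rpow_add_one (by positivity)]
      have h2 : 1 ≤ Real.log n ^ (b + 1) := Real.one_le_rpow hl hb1.le
      have h3 : C ≤ |C| * Real.log n ^ (b + 1) :=
        (le_abs_self C).trans (le_mul_of_one_le_right (abs_nonneg _) h2)
      linarith
    rcases le_or_gt 0 b with hb0 | hb0
    · refine ⟨1, fun n hn m hm hmn => ?_⟩
      have hln := hlog n hn
      have h1 := sum_Icc_le_of_le_sub (a := a) (G := fun i : ℕ => Real.log n ^ b * Real.log i)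
        (r := r₀) (n := n) (mul_nonneg (by positivity) (hlog _ le_rfl).le) (fun i hi hin => by
          have h2 : Real.log (i + 1 : ℕ) ≤ Real.log n := by gcongr; exact hin
          have h3 := hlog (i + 1) (by omega)
          rw [har _ (by omega), ← mul_sub, div_eq_mul_inv]
          gcongr
          exact inv_succ_le_log_sub_log (by omega)) hm hmn
      refine h1.trans ?_
      rw [one_mul, Real.rpow_add_one hln.ne']
      have : (0 : ℝ) < m := by
        have : 0 < m := by omega
        exact_mod_cast this
      gcongr
    · refine ⟨1 / (b + 1), fun n hn m hm hmn => ?_⟩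
      have h1 := sum_Icc_le_of_le_sub (a := a)
        (G := fun i : ℕ => Real.log i ^ (b + 1) / (b + 1))
        (r := r₀) (n := n) (by have := hlog _ le_rfl; positivity) (fun i hi hin => by
          rw [har _ (by omega)]
          exact log_rpow_div_le hb hb0 (by omega)) hm hmn
      refine h1.trans ?_
      have : (0 : ℝ) < m := by
        have : 0 < m := by omega
        exact_mod_cast this
      have := hlog m hm
      rw [one_div_mul_eq_div]
      gcongr

lemma eventually_eq_log_rpow_div {a : ℕ → ℝ} {b : ℝ}
    (ha : ∀ᶠ r : ℕ in atTop, a r = min (Real.log r ^ b / r) 1) :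
    ∀ᶠ r : ℕ in atTop, a r = Real.log r ^ b / r := by
  have h1 := (isLittleO_log_rpow_rpow_atTop b one_pos).comp_tendsto
    (tendsto_natCast_atTop_atTop (R := ℝ))
  filter_upwards [ha, h1.bound one_pos, eventually_ge_atTop 1] with r hr h2 hr1
  have hr0 : (0 : ℝ) < r := by exact_mod_cast hr1
  simp only [Function.comp_apply, Real.rpow_one, one_mul, Real.norm_eq_abs, abs_of_pos hr0] at h2
  rw [hr, min_eq_left]
  rw [div_le_one hr0]
  exact (le_abs_self _).trans h2

/-! ### The covering processes -/

/-- The probabilities that the first `k` objects cover the circle, in the time scale `1 / f n`,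
control both cover times. -/
lemma IsLogSpreadTail.compactSupportPhase {Ω : ℕ → Type*} [∀ n, MeasurableSpace (Ω n)]
    (P : ∀ n, Measure (Ω n)) [∀ n, IsProbabilityMeasure (P n)] {f : ℝ → ℝ}
    {R : ∀ n, ℕ → Ω n → ℕ} {U : ∀ n, ℕ → Ω n → ZMod n} {N : ∀ n, ℝ≥0 → Ω n → ℕ}
    (hmodel : ∀ n, 1 ≤ n → IsCoveringModel f n (P n) (R n) (U n) (N n))
    (ha : IsLogSpreadTail (fun r => f r)) (S : ∀ n, Ω n → ℝ)
    (hS : ∀ n, 1 ≤ n → AEMeasurable (S n) (P n)) (hS0 : ∀ n ω, 0 ≤ S n ω)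
    (hup : ∀ n, 1 ≤ n → ∀ t : ℝ, 0 < t → (P n).real {ω | t < S n ω} ≤
      8 / t + (P n).real {ω | covered (R n) (U n) ⌊t / 2⌋₊ ω ≠ univ})
    (hlow : ∀ n, 1 ≤ n → ∀ t : ℝ, 0 < t → (P n).real {ω | S n ω < t} ≤
      8 / t + (P n).real {ω | covered (R n) (U n) ⌊2 * t⌋₊ ω = univ}) :
    CompactSupportPhase P f S := by
  have h1 := hmodel 1 le_rfl
  have hnonneg (r : ℕ) (hr : 1 ≤ r) : 0 ≤ f r := h1.tail_nonneg hr
  have hanti (r s : ℕ) (hr : 1 ≤ r) (hrs : r ≤ s) : f s ≤ f r := h1.tail_antitone hr hrs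
  have hpos (n : ℕ) (hn : 1 ≤ n) : 0 < f n := by
    obtain ⟨m, hm, hnm⟩ := (ha.pos.and (eventually_ge_atTop n)).exists
    exact hm.trans_le (hanti n m hn hnm)
  refine compactSupportPhase_of_bounds P f S
    (fun n k => (P n).real {ω | covered (R n) (U n) k ω ≠ univ})
    (fun n k => (P n).real {ω | covered (R n) (U n) k ω = univ})
    hpos (fun n hn => h1.tail_le_one hn) h1.tail_tendsto_zero hS hS0 hup hlow ?_ ?_ ?_
  · intro n hn k
    have : NeZero n := ⟨by omega⟩
    exact (hmodel n hn).prob_not_covered_le_exp k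
  · intro ε hε
    have hq : 2 * Real.exp (-2) < 1 := by
      rw [Real.exp_neg, ← div_eq_mul_inv, div_lt_one (Real.exp_pos _)]
      linarith [Real.add_one_le_exp (2 : ℝ)]
    have hlim : Tendsto (fun J : ℕ => 4 * (2 * Real.exp (-2)) ^ J) atTop (𝓝 (4 * 0)) :=
      (tendsto_pow_atTop_nhds_zero_of_lt_one (by positivity) hq).const_mul 4
    rw [mul_zero] at hlim
    obtain ⟨J, hJ⟩ := (hlim.eventually_le_const hε).exists
    filter_upwards [ha.eventually_le_sum hnonneg hanti J, eventually_ge_atTop 1]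
      with n ⟨hm, hcard, hsum⟩ hn k hk
    have : NeZero n := ⟨by omega⟩
    refine ((hmodel n hn).prob_not_covered_le_blocks hm k).trans (le_trans ?_ hJ)
    have hcard' : ((n / (n / 2 ^ J) : ℕ) : ℝ) + 1 ≤ 2 ^ (J + 2) := by exact_mod_cast hcard
    have hexp : 2 * (J : ℝ) ≤ k * ((∑ j ∈ Finset.range n, f ((j + n / 2 ^ J : ℕ))) / n) := by
      calc 2 * (J : ℝ) = 16 * (J / 8) := by ring
        _ ≤ k * f n * (J / 8) := by gcongr
        _ = k * (J * f n / 8) := by ring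
        _ ≤ _ := by gcongr
    calc _ ≤ 2 ^ (J + 2) * Real.exp (-(2 * (J : ℝ))) := by gcongr
      _ = 4 * (2 * Real.exp (-2)) ^ J := by
          rw [mul_pow, ← Real.exp_nat_mul, pow_add]; ring_nf
  · intro ε hε
    obtain ⟨α, hα, hsum⟩ := ha.eventually_sum_exp_le hnonneg hε
    refine ⟨α, hα, ?_⟩
    have hq := (h1.tail_tendsto_zero.comp (tendsto_add_atTop_nat 1)).cesaro
    filter_upwards [hsum, hq.eventually_le_const one_half_pos, eventually_ge_atTop 1]
      with n hs hq hn k hk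
    have : NeZero n := ⟨by omega⟩
    refine ((hmodel n hn).prob_covered_le_sum_exp k ?_).trans (hs k hk)
    rw [div_eq_inv_mul]
    exact hq

lemma IsLogSpreadTail.compactSupportPhase_coverTimes {Ω : ℕ → Type*} [∀ n, MeasurableSpace (Ω n)]
    (P : ∀ n, Measure (Ω n)) [∀ n, IsProbabilityMeasure (P n)] {f : ℝ → ℝ}
    {R : ∀ n, ℕ → Ω n → ℕ} {U : ∀ n, ℕ → Ω n → ZMod n} {N : ∀ n, ℝ≥0 → Ω n → ℕ}
    (hmodel : ∀ n, 1 ≤ n → IsCoveringModel f n (P n) (R n) (U n) (N n))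
    (ha : IsLogSpreadTail (fun r => f r)) :
    CompactSupportPhase P f (fun n => coverTime (R n) (U n) (N n)) ∧
      CompactSupportPhase P f (fun n => discreteCoverTime (R n) (U n)) := by
  have hne (n : ℕ) (hn : 1 ≤ n) : NeZero n := ⟨by omega⟩
  constructor
  · refine ha.compactSupportPhase P hmodel _ (fun n hn => ?_) (fun n ω => NNReal.coe_nonneg _)
      (fun n hn t ht => ?_) (fun n hn t ht => ?_) <;> have := hne n hn
    · exact (hmodel n hn).measurable_coverTime.aemeasurable
    · exact (hmodel n hn).prob_lt_coverTime_le ht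
    · exact (hmodel n hn).prob_coverTime_lt_le ht
  · refine ha.compactSupportPhase P hmodel _ (fun n hn => ?_) (fun n ω => Nat.cast_nonneg _)
      (fun n hn t ht => ?_) (fun n hn t ht => ?_) <;> have := hne n hn
    · exact (hmodel n hn).measurable_discreteCoverTime.aemeasurable
    · exact prob_lt_discreteCoverTime_le ht
    · exact (hmodel n hn).prob_discreteCoverTime_lt_le ht

end Covering

theorem theoremB {Ω : ℕ → Type*} [∀ n, MeasurableSpace (Ω n)]
    (P : ∀ n, Measure (Ω n)) [∀ n, IsProbabilityMeasure (P n)]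
    (f : ℝ → ℝ)
    (R : ∀ n, ℕ → Ω n → ℕ) (U : ∀ n, ℕ → Ω n → ZMod n) (N : ∀ n, ℝ≥0 → Ω n → ℕ)
    (hmodel : ∀ n, 1 ≤ n → Covering.IsCoveringModel f n (P n) (R n) (U n) (N n)) :
    -- the space is almost surely covered in finite time
    (∀ n, 1 ≤ n → ∀ᵐ ω ∂(P n), ∃ t : ℝ≥0, Covering.coveredAt (R n) (U n) (N n) t ω = Set.univ) ∧
    -- the general version
    (Covering.IsRegularlyVarying f (-1) → Covering.UniformBound f → Covering.PartialSumBound f →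
      Covering.CompactSupportPhase P f (fun n => Covering.coverTime (R n) (U n) (N n)) ∧
      Covering.CompactSupportPhase P f (fun n => Covering.discreteCoverTime (R n) (U n))) ∧
    -- the special case `f(r) = min {ln^b r / r, 1}`
    (∀ b : ℝ, -1 < b → (∀ᶠ r : ℕ in atTop, f r = min (Real.log r ^ b / r) 1) →
      Covering.CompactSupportPhase P f (fun n => Covering.coverTime (R n) (U n) (N n)) ∧
      Covering.CompactSupportPhase P f (fun n => Covering.discreteCoverTime (R n) (U n))) := by
  refine ⟨fun n hn => ?_, fun hf hu hp => ?_, fun b hb hf => ?_⟩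
  · have : NeZero n := ⟨by omega⟩
    exact (hmodel n hn).ae_exists_coveredAt
  · refine Covering.IsLogSpreadTail.compactSupportPhase_coverTimes P hmodel
      (hf.isLogSpreadTail hu hp fun r hr => (hmodel 1 le_rfl).tail_nonneg hr)
  · exact Covering.IsLogSpreadTail.compactSupportPhase_coverTimes P hmodel
      (Covering.isLogSpreadTail_of_eq_log_rpow hb (Covering.eventually_eq_log_rpow_div hf))
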